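/- Let $\kappa>0$ and let $\mathbb{H}^3_{-\kappa}$ be hyperbolic $3$-space of sectional curvature $-\kappa$ in static coordinates, i.e. $\mathbb{R}^3$ with the metric $g=\frac{1}{f^2}\,dr^2+r^2 g_{S^2}$, where $f=\sqrt{1+\kappa r^2}$. Let $D$ be its Levi-Civita connection (and the induced connection on vector fields along maps), let $X=rf\,\frac{\partial}{\partial r}$, and let $\times$ be the cross product of $g$ for the standard orientation. A constant vector field is one of the form $\sum_i a^i\frac{\partial}{\partial x^i}$ with $a^i\in\mathbb{R}$. Let $\sigma$ be a smooth Riemannian metric on $S^2$ and let $\mathbf{r}:(S^2,\sigma)\to(\mathbb{H}^3_{-\kappa},g)$ be a smooth isometric embedding whose image is a convex surface, in the sense that its second fundamental form $h(\xi,\eta)=g(D_\xi\nu,\mathbf{r}_*\eta)$ with respect to a suitable smooth unit normal field $\nu$ is positive definite at every point. Then $\mathbf{r}$ is infinitesimally rigid: every infinitesimal isometric deformation of $\mathbf{r}$, i.e. every smooth vector field $\tau$ along $\mathbf{r}$ with $$g(\mathbf{r}_*\xi,D_\eta\tau)+g(\mathbf{r}_*\eta,D_\xi\tau)=0\qquad\text{for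 all }p\in S^2,\ \xi,\eta\in T_pS^2,$$ is the restriction to the surface of a Killing field of $\mathbb{H}^3_{-\kappa}$. More precisely, for every such $\tau$ there are constant vector fields $Y_0,Z_0$ such that $Y_0\times X+fZ_0$ is a Killing field and $\tau=(Y_0\times X+fZ_0)\circ\mathbf{r}$. -/

import Mathlib

open scoped Manifold ContDiff InnerProductSpace

noncomputable section

namespace HypRigid

/-- The static coordinate space `ℝ³` of hyperbolic `3`-space. -/
abbrev E3 : Type := EuclideanSpace ℝ (Fin 3)

/-- The `2`-sphere, with Mathlib's smooth structure. -/
abbrev S2 : Type := Metric.sphere (0 : E3) 1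

/-- A smooth Riemannian metric on the `2`-sphere. -/
abbrev SphereMetric : Type :=
  Bundle.ContMDiffRiemannianMetric (𝓡 2) ∞ (EuclideanSpace ℝ (Fin 2))
    (fun p : S2 => TangentSpace (𝓡 2) p)

/-! ### Hyperbolic space of curvature `-κ` in static coordinates -/

/-- The static potential `f = √(1 + κ r²)`. -/
def staticPotential (κ : ℝ) (x : E3) : ℝ := Real.sqrt (1 + κ * ‖x‖ ^ 2)

/-- The hyperbolic metric `g = f⁻² dr² + r² g_{S²}` on `ℝ³`. As `|u|² = dr(u)² + r² g_{S²}(u, u)`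
and `f⁻² = 1 - κ r² / f²`, it reads `g_x(u, v) = ⟪u, v⟫ - κ ⟪x, u⟫ ⟪x, v⟫ / (1 + κ r²)` in
Cartesian coordinates, which is smooth also at the origin. -/
def hypMetric (κ : ℝ) (x u v : E3) : ℝ :=
  ⟪u, v⟫_ℝ - κ * ⟪x, u⟫_ℝ * ⟪x, v⟫_ℝ / (1 + κ * ‖x‖ ^ 2)

/-- The Christoffel symbols `Γ_x(u, v)` of the Levi-Civita connection of `g` in static
coordinates. They are symmetric in `u` and `v`, and `fderiv_hypMetric` shows that they are
compatible with the metric, which characterizes them. -/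
def christoffel (κ : ℝ) (x u v : E3) : E3 := (-(κ * hypMetric κ x u v)) • x

/-- The covariant derivative `D_u W` at `x` of a vector field `W` on hyperbolic space. -/
def covDeriv (κ : ℝ) (W : E3 → E3) (x u : E3) : E3 :=
  fderiv ℝ W x u + christoffel κ x u (W x)

/-- `W` is a Killing field of `(ℝ³, g)`: a smooth vector field such that `u ↦ D_u W` is
skew-symmetric. -/
def IsKillingField (κ : ℝ) (W : E3 → E3) : Prop :=
  ContDiff ℝ ∞ W ∧
    ∀ x u v : E3, hypMetric κ x (covDeriv κ W x u) v + hypMetric κ x u (covDeriv κ W x v) = 0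

/-- The conformal Killing field `X = r f ∂/∂r`. -/
def confKilling (κ : ℝ) (x : E3) : E3 := staticPotential κ x • x

/-- The cross product of Euclidean `3`-space. -/
def euclCross (u v : E3) : E3 := WithLp.toLp 2 (crossProduct (WithLp.ofLp u) (WithLp.ofLp v))

/-- The cross product of `T_x ℝ³` with respect to the metric `g` and the standard orientation: the
volume form of `g` is `f⁻¹ dx¹ ∧ dx² ∧ dx³`, and `u × v` is the vector that satisfies
`g_x(u × v, w) = f⁻¹ det(u, v, w)` for all `w`, see `hypMetric_hypCross`. -/
def hypCross (κ : ℝ) (x u v : E3) : E3 :=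
  (staticPotential κ x)⁻¹ • (euclCross u v + (κ * ⟪x, euclCross u v⟫_ℝ) • x)

/-- The vector field `Y₀ × X + f Z₀`, for constant vector fields `Y₀`, `Z₀` in static
coordinates. -/
def killingField (κ : ℝ) (Y₀ Z₀ : E3) (x : E3) : E3 :=
  hypCross κ x Y₀ (confKilling κ x) + staticPotential κ x • Z₀

/-! ### Surfaces -/

/-- The differential `r_* ξ` of a map `r` from the sphere, in static coordinates. -/
def differential (r : S2 → E3) (p : S2) (ξ : TangentSpace (𝓡 2) p) : E3 :=
  mfderiv (𝓡 2) 𝓘(ℝ, E3) r p ξ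

/-- The pull-back connection: the covariant derivative `D_ξ V` of a section `V` of the pull-back
`r⁻¹ T ℝ³` of the tangent bundle. -/
def covDerivAlong (κ : ℝ) (r V : S2 → E3) (p : S2) (ξ : TangentSpace (𝓡 2) p) : E3 :=
  differential V p ξ + christoffel κ (r p) (differential r p ξ) (V p)

/-- `r` is a smooth isometric embedding of `(S², σ)` into hyperbolic space. That it is an
immersion follows from `r^* g = σ`. -/
structure IsIsometricEmbedding (κ : ℝ) (σ : SphereMetric) (r : S2 → E3) : Prop where
  smooth : ContMDiff (𝓡 2) 𝓘(ℝ, E3) ∞ r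
  embedding : Topology.IsEmbedding r
  isometric : ∀ (p : S2) (ξ η : TangentSpace (𝓡 2) p),
    hypMetric κ (r p) (differential r p ξ) (differential r p η) = σ.inner p ξ η

/-- `ν` is a smooth unit normal field along `r`. -/
structure IsUnitNormal (κ : ℝ) (r ν : S2 → E3) : Prop where
  smooth : ContMDiff (𝓡 2) 𝓘(ℝ, E3) ∞ ν
  unit : ∀ p : S2, hypMetric κ (r p) (ν p) (ν p) = 1
  normal : ∀ (p : S2) (ξ : TangentSpace (𝓡 2) p), hypMetric κ (r p) (ν p) (differential r p ξ) = 0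

/-- The second fundamental form `h(ξ, η) = g(D_ξ ν, r_* η)`. -/
def secondFundamentalForm (κ : ℝ) (r ν : S2 → E3) (p : S2) (ξ η : TangentSpace (𝓡 2) p) : ℝ :=
  hypMetric κ (r p) (covDerivAlong κ r ν p ξ) (differential r p η)

/-- The image of `r` is a convex surface: for a suitable unit normal field (then the outward one),
the second fundamental form is positive definite everywhere. -/
def IsConvexSurface (κ : ℝ) (r : S2 → E3) : Prop :=
  ∃ ν : S2 → E3, IsUnitNormal κ r ν ∧
    ∀ (p : S2) (ξ : TangentSpace (𝓡 2) p), ξ ≠ 0 → 0 < secondFundamentalForm κ r ν p ξ ξ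

/-- The symmetric product `(α ⊙ β)(ξ, η) = (g(α ξ, β η) + g(α η, β ξ)) / 2` at `p` of one-forms
with values in the pull-back of the tangent bundle along `r`. -/
def symProd (κ : ℝ) (r : S2 → E3) (p : S2) (α β : TangentSpace (𝓡 2) p → E3)
    (ξ η : TangentSpace (𝓡 2) p) : ℝ :=
  (hypMetric κ (r p) (α ξ) (β η) + hypMetric κ (r p) (α η) (β ξ)) / 2

/-- `τ` is an infinitesimal isometric deformation of `r`: a smooth section of the pull-back of the
tangent bundle with `D r ⊙ D τ = 0`. -/
structure IsInfinitesimalDeformation (κ : ℝ) (r τ : S2 → E3) : Prop where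
  smooth : ContMDiff (𝓡 2) 𝓘(ℝ, E3) ∞ τ
  equation : ∀ (p : S2) (ξ η : TangentSpace (𝓡 2) p),
    symProd κ r p (differential r p) (covDerivAlong κ r τ p) ξ η = 0

/-- `τ` is trivial: it is the restriction of a Killing field to the surface. -/
def IsTrivialDeformation (κ : ℝ) (r τ : S2 → E3) : Prop :=
  ∃ W : E3 → E3, IsKillingField κ W ∧ ∀ p : S2, τ p = W (r p)

/-- `r` is infinitesimally rigid: it has only trivial infinitesimal deformations. -/
def IsInfinitesimallyRigid (κ : ℝ) (r : S2 → E3) : Prop :=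
  ∀ τ : S2 → E3, IsInfinitesimalDeformation κ r τ → IsTrivialDeformation κ r τ

/-! ### The connection and the cross product belong to the metric -/

theorem one_add_pos {κ : ℝ} (hκ : 0 < κ) (x : E3) : 0 < 1 + κ * ‖x‖ ^ 2 := by positivity

theorem christoffel_symm (κ : ℝ) (x u v : E3) : christoffel κ x u v = christoffel κ x v u := by
  have h : hypMetric κ x u v = hypMetric κ x v u := by
    simp only [hypMetric, real_inner_comm]
    ring
  simp only [christoffel, h]

theorem fderiv_hypMetric {κ : ℝ} (hκ : 0 < κ) (x u v w : E3) :
    fderiv ℝ (fun y => hypMetric κ y u v) x w =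
      hypMetric κ x (christoffel κ x w u) v + hypMetric κ x u (christoffel κ x w v) := by
  have hp := one_add_pos hκ x
  have h1 : ∀ a : E3, HasFDerivAt (fun y : E3 => ⟪y, a⟫_ℝ) (innerSL ℝ a) x := by
    intro a
    have := (innerSL ℝ a).hasFDerivAt (x := x)
    refine this.congr_of_eventuallyEq (Filter.Eventually.of_forall fun y => ?_)
    simp [real_inner_comm]
  have h2 : HasFDerivAt (fun y : E3 => 1 + κ * ‖y‖ ^ 2) (κ • (2 • innerSL ℝ x)) x := by
    have := (hasStrictFDerivAt_norm_sq x).hasFDerivAt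
    exact (this.const_mul κ).const_add 1
  have hinv : HasFDerivAt (fun y : E3 => (1 + κ * ‖y‖ ^ 2)⁻¹)
      ((-((1 + κ * ‖x‖ ^ 2) ^ 2)⁻¹) • (κ • (2 • innerSL ℝ x))) x :=
    (hasDerivAt_inv hp.ne').comp_hasFDerivAt x h2
  have h3 : HasFDerivAt (fun y => hypMetric κ y u v) _ x :=
    ((((h1 u).const_mul κ).mul (h1 v)).mul hinv).const_sub ⟪u, v⟫_ℝ
  rw [h3.fderiv]
  simp [hypMetric, christoffel, inner_smul_left, inner_smul_right]
  have e1 := real_inner_comm x u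
  have e4 := real_inner_comm w u
  have e5 := real_inner_comm w v
  simp only [e1, e4, e5]
  field_simp
  ring

theorem hypMetric_hypCross {κ : ℝ} (hκ : 0 < κ) (x u v w : E3) :
    hypMetric κ x (hypCross κ x u v) w =
      (staticPotential κ x)⁻¹ *
        Matrix.det (Matrix.of ![WithLp.ofLp u, WithLp.ofLp v, WithLp.ofLp w]) := by
  have hp := one_add_pos hκ x
  have hd : Matrix.det (Matrix.of ![WithLp.ofLp u, WithLp.ofLp v, WithLp.ofLp w]) =
      ⟪euclCross u v, w⟫_ℝ := by
    simp [Matrix.det_fin_three, euclCross, crossProduct, PiLp.inner_apply, Fin.sum_univ_three]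
    ring
  rw [hd]
  simp only [hypMetric, hypCross, inner_smul_left, inner_smul_right, inner_add_left,
    inner_add_right, real_inner_self_eq_norm_sq, conj_trivial]
  field_simp
  ring

end HypRigid

end

open scoped Manifold ContDiff InnerProductSpace

noncomputable section

namespace HypRigid

/-! ### Algebra of the Euclidean cross product -/

/-! The projective (Klein) map `x ↦ x / f` reduces the claim to Euclidean space. Put `R = r / f` and
`T = τ / f`. Euclidean products with `dR` are `f⁻¹` times `g`-products with `dr`
(`inner_fderiv_projectiveModel`), so `R` is again locally convex, with normal parallel to `ν`, and
`T` is an infinitesimal isometric deformation of `R`. If `T = A × R + B`, then `τ = A × r + f B`,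
which is `killingField κ A B` along `r`.

The Euclidean statement, `euclidean_rigidity`, is Blaschke's argument. Write `dT = Y × dR`.
Integrability makes `dY` tangent to the surface and trace-free; it is also self-adjoint for the
second fundamental form, hence has determinant `k ≤ 0`, with equality only if `dY = 0`
(`crossL_eq_nonpos_smul`). The exterior derivative of `⟪R - o, Y × dY⟫` is, up to a constant, `k ⟪R
- o, N⟫` times the area form, and its integral is zero by Stokes. For `o` on the surface, `⟪R - o,
N⟫ ≥ 0` by Hadamard's theorem (`support_pos`): the Gauss map is a local homeomorphism of the sphere,
hence injective, so each height function has only one maximum. Therefore `dY = 0`, so `Y` and then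
`T - Y × R` are constant.

Maps on the sphere are extended to be constant along rays of the punctured space, so that calculus
is done with `fderiv` and Stokes' theorem becomes the vanishing of the integral of a divergence. -/

theorem inner_eq_coord (u v : E3) : ⟪u, v⟫_ℝ = u 0 * v 0 + u 1 * v 1 + u 2 * v 2 := by
  simp [PiLp.inner_apply, Fin.sum_univ_three]
  ring

@[simp] theorem euclCross_apply_zero (u v : E3) : euclCross u v 0 = u 1 * v 2 - u 2 * v 1 := by
  simp [euclCross, crossProduct]

@[simp] theorem euclCross_apply_one (u v : E3) : euclCross u v 1 = u 2 * v 0 - u 0 * v 2 := by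
  simp [euclCross, crossProduct]

@[simp] theorem euclCross_apply_two (u v : E3) : euclCross u v 2 = u 0 * v 1 - u 1 * v 0 := by
  simp [euclCross, crossProduct]

theorem E3_ext {u v : E3} (h0 : u 0 = v 0) (h1 : u 1 = v 1) (h2 : u 2 = v 2) : u = v := by
  ext i
  fin_cases i
  exacts [h0, h1, h2]

/-- The cross product as a continuous bilinear map. -/
def crossL : E3 →L[ℝ] E3 →L[ℝ] E3 :=
  LinearMap.toContinuousLinearMap
    ((LinearMap.toContinuousLinearMap (𝕜 := ℝ) (E := E3) (F' := E3)).toLinearMap ∘ₗ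
      LinearMap.mk₂ ℝ euclCross
        (fun a b c => by apply E3_ext <;> simp <;> ring)
        (fun a b c => by apply E3_ext <;> simp <;> ring)
        (fun a b c => by apply E3_ext <;> simp <;> ring)
        (fun a b c => by apply E3_ext <;> simp <;> ring))

theorem crossL_apply (u v : E3) : crossL u v = euclCross u v := rfl

@[simp] theorem crossL_apply_zero (u v : E3) : crossL u v 0 = u 1 * v 2 - u 2 * v 1 :=
  euclCross_apply_zero u v

@[simp] theorem crossL_apply_one (u v : E3) : crossL u v 1 = u 2 * v 0 - u 0 * v 2 :=
  euclCross_apply_one u v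

@[simp] theorem crossL_apply_two (u v : E3) : crossL u v 2 = u 0 * v 1 - u 1 * v 0 :=
  euclCross_apply_two u v

theorem crossL_self (u : E3) : crossL u u = 0 := by
  apply E3_ext <;> simp <;> ring

theorem crossL_anticomm (u v : E3) : crossL u v = -crossL v u := by
  apply E3_ext <;> simp <;> ring

theorem inner_crossL_right (u v : E3) : ⟪v, crossL u v⟫_ℝ = 0 := by
  simp [inner_eq_coord]; ring

theorem inner_crossL_cyclic (u v w : E3) : ⟪u, crossL v w⟫_ℝ = ⟪v, crossL w u⟫_ℝ := by
  simp [inner_eq_coord]; ring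

theorem norm_crossL_sq (u v : E3) :
    ⟪crossL u v, crossL u v⟫_ℝ = ⟪u, u⟫_ℝ * ⟪v, v⟫_ℝ - ⟪u, v⟫_ℝ ^ 2 := by
  simp only [inner_eq_coord, crossL_apply_zero, crossL_apply_one, crossL_apply_two]; ring

/-- Decomposition of a vector in the frame `a`, `b`, `a × b`. -/
theorem crossL_decomposition (a b c : E3) :
    ⟪crossL a b, crossL a b⟫_ℝ • c = ⟪crossL c b, crossL a b⟫_ℝ • a +
      ⟪crossL a c, crossL a b⟫_ℝ • b + ⟪c, crossL a b⟫_ℝ • crossL a b := by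
  apply E3_ext <;>
    simp only [inner_eq_coord, crossL_apply_zero, crossL_apply_one, crossL_apply_two,
      PiLp.smul_apply, PiLp.add_apply, smul_eq_mul] <;> ring

theorem inner_self_pos_of_ne {a : E3} (h : a ≠ 0) : 0 < ⟪a, a⟫_ℝ := by
  rw [real_inner_self_eq_norm_sq]; positivity

theorem exists_combination {a b c : E3} (hm : crossL a b ≠ 0) (hc : ⟪c, crossL a b⟫_ℝ = 0) :
    ∃ s t : ℝ, c = s • a + t • b := by
  have h := crossL_decomposition a b c
  have hp := (inner_self_pos_of_ne hm).ne'
  rw [hc, zero_smul, add_zero] at h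
  refine ⟨(⟪crossL a b, crossL a b⟫_ℝ)⁻¹ * ⟪crossL c b, crossL a b⟫_ℝ,
    (⟪crossL a b, crossL a b⟫_ℝ)⁻¹ * ⟪crossL a c, crossL a b⟫_ℝ, ?_⟩
  rw [mul_smul, mul_smul, ← smul_add, ← h, smul_smul, inv_mul_cancel₀ hp, one_smul]

theorem eq_zero_of_inner_frame {a b c : E3} (hm : crossL a b ≠ 0) (ha : ⟪c, a⟫_ℝ = 0)
    (hb : ⟪c, b⟫_ℝ = 0) (hc : ⟪c, crossL a b⟫_ℝ = 0) : c = 0 := by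
  obtain ⟨s, t, h⟩ := exists_combination hm hc
  have : ⟪c, c⟫_ℝ = 0 := by
    nth_rewrite 2 [h]
    rw [inner_add_right, inner_smul_right, inner_smul_right, ha, hb]; simp
  exact inner_self_eq_zero.1 this

/-- Such a `c` is parallel to two independent vectors. This gives the uniqueness of rotation
vectors. -/
theorem eq_zero_of_crossL_frame {a b c : E3} (hm : crossL a b ≠ 0) (ha : crossL c a = 0)
    (hb : crossL c b = 0) : c = 0 := by
  have h := crossL_decomposition a b c
  have h2 : crossL a c = 0 := by rw [crossL_anticomm, ha, neg_zero]
  have h3 : ⟪c, crossL a b⟫_ℝ = 0 := by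
    rw [inner_crossL_cyclic, crossL_anticomm, hb]; simp
  rw [hb, h2, h3] at h
  simp only [inner_zero_left, zero_smul, add_zero] at h
  exact (smul_eq_zero.1 h).resolve_left (inner_self_pos_of_ne hm).ne'

/-- A pair completing `x` to a basis stands in for a chart of the sphere; being an open condition in
`x`, it also serves nearby points. -/
theorem exists_complementary_pair {x : E3} (hx : x ≠ 0) : ∃ u v : E3, ⟪x, crossL u v⟫_ℝ ≠ 0 := by
  by_contra! h
  apply hx
  apply E3_ext
  · simpa [inner_eq_coord] using h (EuclideanSpace.single 1 1) (EuclideanSpace.single 2 1)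
  · simpa [inner_eq_coord] using h (EuclideanSpace.single 2 1) (EuclideanSpace.single 0 1)
  · simpa [inner_eq_coord] using h (EuclideanSpace.single 0 1) (EuclideanSpace.single 1 1)

/-- The flux density through spheres of the vector-valued two-form `(u, v) ↦ P u × P v`. -/
def fluxCross (x : E3) (P : E3 →L[ℝ] E3) : E3 :=
  x 0 • crossL (P (EuclideanSpace.single 1 1)) (P (EuclideanSpace.single 2 1)) +
    x 1 • crossL (P (EuclideanSpace.single 2 1)) (P (EuclideanSpace.single 0 1)) +
    x 2 • crossL (P (EuclideanSpace.single 0 1)) (P (EuclideanSpace.single 1 1))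

theorem map_eq_coord (P : E3 →L[ℝ] E3) (u : E3) : P u = u 0 • P (EuclideanSpace.single 0 1) +
    u 1 • P (EuclideanSpace.single 1 1) + u 2 • P (EuclideanSpace.single 2 1) := by
  rw [← map_smul, ← map_smul, ← map_smul, ← map_add, ← map_add]
  congr 1
  apply E3_ext <;> simp

/-- A two-form annihilated by the radial direction is determined by its flux through spheres, so
identities between values on one pair `u`, `v` become identities between flux densities. -/
theorem fluxCross_eq {x : E3} {P : E3 →L[ℝ] E3} (hP : P x = 0) (u v : E3) :
    ⟪x, crossL u v⟫_ℝ • fluxCross x P = ⟪x, x⟫_ℝ • crossL (P u) (P v) := by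
  unfold fluxCross
  rw [map_eq_coord P u, map_eq_coord P v]
  rw [map_eq_coord] at hP
  set a := P (EuclideanSpace.single 0 1)
  set b := P (EuclideanSpace.single 1 1)
  set c := P (EuclideanSpace.single 2 1)
  -- Crossing `P x = 0` with `a`, `b`, `c` shows that `(b × c, c × a, a × b)` is proportional to `(x
  -- 0, x 1, x 2)`.
  have hca : x 1 • crossL a b = x 2 • crossL c a := by
    have h : crossL a (x 0 • a + x 1 • b + x 2 • c) = 0 := by rw [hP, map_zero]
    simp only [map_add, map_smul, crossL_self, smul_zero, zero_add] at h
    rw [crossL_anticomm a c, smul_neg, ← sub_eq_add_neg, sub_eq_zero] at h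
    exact h
  have hab : x 2 • crossL b c = x 0 • crossL a b := by
    have h : crossL b (x 0 • a + x 1 • b + x 2 • c) = 0 := by rw [hP, map_zero]
    simp only [map_add, map_smul, crossL_self, smul_zero, add_zero] at h
    rw [crossL_anticomm b a, smul_neg, neg_add_eq_sub, sub_eq_zero] at h
    exact h
  have hbc : x 1 • crossL b c = x 0 • crossL c a := by
    have h : crossL c (x 0 • a + x 1 • b + x 2 • c) = 0 := by rw [hP, map_zero]
    simp only [map_add, map_smul, crossL_self, smul_zero, add_zero] at h
    rw [crossL_anticomm c b, smul_neg, ← sub_eq_add_neg, sub_eq_zero] at h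
    exact h.symm
  have huv : crossL (u 0 • a + u 1 • b + u 2 • c) (v 0 • a + v 1 • b + v 2 • c) =
      crossL u v 0 • crossL b c + crossL u v 1 • crossL c a + crossL u v 2 • crossL a b := by
    apply E3_ext <;> simp <;> ring
  rw [huv, inner_eq_coord x, inner_eq_coord x]
  generalize crossL b c = A at *
  generalize crossL c a = B at *
  generalize crossL a b = C at *
  generalize crossL u v = w at *
  have k (i : Fin 3) : x 1 * C i = x 2 * B i ∧ x 2 * A i = x 0 * C i ∧ x 1 * A i = x 0 * B i :=
    ⟨by simpa using congrArg (fun z : E3 => z i) hca, by simpa using congrArg (fun z : E3 => z i) hab,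
      by simpa using congrArg (fun z : E3 => z i) hbc⟩
  ext i
  obtain ⟨k1, k2, k3⟩ := k i
  simp only [PiLp.smul_apply, PiLp.add_apply, smul_eq_mul]
  linear_combination (x 2 * w 1 - x 1 * w 2) * k1 + (x 0 * w 2 - x 2 * w 0) * k2 +
    (x 0 * w 1 - x 1 * w 0) * k3

/-! ### Convex immersions, extended radially to the punctured space -/

/-- `R` is a convex immersion of the sphere into Euclidean space with unit normal `N`, both
extended to the punctured space as functions that are constant along rays. -/
structure IsConvexImmersion (R N : E3 → E3) : Prop where
  smooth : ∀ x ≠ 0, ContDiffAt ℝ ∞ R x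
  smooth_normal : ∀ x ≠ 0, ContDiffAt ℝ ∞ N x
  radial : ∀ x ≠ 0, ∀ t : ℝ, 0 < t → R (t • x) = R x
  radial_normal : ∀ x ≠ 0, ∀ t : ℝ, 0 < t → N (t • x) = N x
  unit : ∀ x ≠ 0, ⟪N x, N x⟫_ℝ = 1
  normal : ∀ x ≠ 0, ∀ v, ⟪N x, fderiv ℝ R x v⟫_ℝ = 0
  convex : ∀ x ≠ 0, ∀ v, crossL x v ≠ 0 → 0 < ⟪fderiv ℝ N x v, fderiv ℝ R x v⟫_ℝ

theorem crossL_combination_ne_zero {x u v : E3} (h : ⟪x, crossL u v⟫_ℝ ≠ 0) {s t : ℝ}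
    (hst : s ≠ 0 ∨ t ≠ 0) : crossL x (s • u + t • v) ≠ 0 := by
  intro h0
  have h1 : s * ⟪x, crossL u v⟫_ℝ = 0 := by
    have : ⟪v, crossL x (s • u + t • v)⟫_ℝ = s * ⟪x, crossL u v⟫_ℝ := by
      simp [inner_eq_coord]; ring
    rw [← this, h0, inner_zero_right]
  have h2 : t * ⟪x, crossL u v⟫_ℝ = 0 := by
    have : ⟪u, crossL x (s • u + t • v)⟫_ℝ = -(t * ⟪x, crossL u v⟫_ℝ) := by
      simp [inner_eq_coord]; ring
    rw [← neg_eq_zero, ← this, h0, inner_zero_right]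
  rcases hst with hs | ht
  · exact (mul_ne_zero hs h) h1
  · exact (mul_ne_zero ht h) h2

/-- A linear map that vanishes on a frame vanishes. -/
theorem clm_eq_zero_of_frame {P : E3 →L[ℝ] E3} {x u v : E3} (h : ⟪x, crossL u v⟫_ℝ ≠ 0)
    (hx : P x = 0) (hu : P u = 0) (hv : P v = 0) : P = 0 := by
  ext1 w
  have key : ⟪x, crossL u v⟫_ℝ • w =
      ⟪w, crossL u v⟫_ℝ • x + ⟪w, crossL v x⟫_ℝ • u + ⟪w, crossL x u⟫_ℝ • v := by
    apply E3_ext <;> simp [inner_eq_coord] <;> ring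
  have := congrArg P key
  simp only [map_add, map_smul, hx, hu, hv, smul_zero, add_zero] at this
  exact (smul_eq_zero.1 this).resolve_left h

theorem fderiv_radial {F : E3 → E3} {x : E3} (hF : DifferentiableAt ℝ F x)
    (h : ∀ t : ℝ, 0 < t → F (t • x) = F x) : fderiv ℝ F x x = 0 := by
  have h1 : HasDerivAt (fun t : ℝ => t • x) x 1 := by
    simpa using (hasDerivAt_id (1 : ℝ)).smul_const x
  have h2 : HasDerivAt (fun t : ℝ => F (t • x)) (fderiv ℝ F x x) 1 := by
    have : HasFDerivAt F (fderiv ℝ F x) ((1 : ℝ) • x) := by simpa using hF.hasFDerivAt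
    exact this.comp_hasDerivAt (1 : ℝ) h1
  have h3 : HasDerivAt (fun t : ℝ => F (t • x)) 0 1 := by
    refine (hasDerivAt_const (1 : ℝ) (F x)).congr_of_eventuallyEq ?_
    filter_upwards [lt_mem_nhds one_pos] with t ht using h t ht
  exact h2.unique h3

theorem contDiffAt_fderiv_apply {F : Type*} [NormedAddCommGroup F] [NormedSpace ℝ F]
    {f : E3 → F} {x : E3} (hf : ContDiffAt ℝ ∞ f x) (v : E3) :
    ContDiffAt ℝ ∞ (fun y => fderiv ℝ f y v) x :=
  (hf.fderiv_right (m := ∞) (by simp)).clm_apply contDiffAt_const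

theorem fderiv_fderiv_apply_comm {F : Type*} [NormedAddCommGroup F] [NormedSpace ℝ F]
    {f : E3 → F} {x : E3} (hf : ContDiffAt ℝ ∞ f x) (u v : E3) :
    fderiv ℝ (fun y => fderiv ℝ f y v) x u = fderiv ℝ (fun y => fderiv ℝ f y u) x v := by
  have hd : DifferentiableAt ℝ (fderiv ℝ f) x :=
    (hf.fderiv_right (m := ∞) (by simp)).differentiableAt (by simp)
  have e (w z : E3) : fderiv ℝ (fun y => fderiv ℝ f y w) x z = fderiv ℝ (fderiv ℝ f) x z w := by
    rw [fderiv_clm_apply hd (differentiableAt_const _)]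
    simp
  rw [e, e]
  exact (hf.isSymmSndFDerivAt (by simpa using WithTop.coe_le_coe.2 (le_top (a := (2 : ℕ∞))))).eq u v

theorem hasFDerivAt_of_contDiffAt {F : Type*} [NormedAddCommGroup F] [NormedSpace ℝ F]
    {f : E3 → F} {x : E3} (hf : ContDiffAt ℝ ∞ f x) : HasFDerivAt f (fderiv ℝ f x) x :=
  (hf.differentiableAt (by simp)).hasFDerivAt

namespace IsConvexImmersion

variable {R N : E3 → E3} (H : IsConvexImmersion R N)
include H

theorem fderiv_self {x : E3} (hx : x ≠ 0) : fderiv ℝ R x x = 0 :=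
  fderiv_radial ((H.smooth x hx).differentiableAt (by simp)) (H.radial x hx)

/-- Convexity already forces `R` to be an immersion: if `P u`, `P v` were parallel, a non-radial
combination of `u` and `v` would be killed by `P`, and the second fundamental form would vanish on
it. -/
theorem cross_ne_zero {x : E3} (hx : x ≠ 0) {u v : E3} (h : ⟪x, crossL u v⟫_ℝ ≠ 0) :
    crossL (fderiv ℝ R x u) (fderiv ℝ R x v) ≠ 0 := by
  intro h0
  set P := fderiv ℝ R x
  have hu : crossL x u ≠ 0 := by
    simpa using crossL_combination_ne_zero h (s := 1) (t := 0) (by simp)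
  have hPu : P u ≠ 0 := by
    intro h1
    have := H.convex x hx u hu
    rw [show fderiv ℝ R x u = 0 from h1, inner_zero_right] at this
    exact lt_irrefl _ this
  have e : ⟪P u, P u⟫_ℝ • P v - ⟪P u, P v⟫_ℝ • P u = crossL (crossL (P u) (P v)) (P u) := by
    apply E3_ext <;> simp only [inner_eq_coord, crossL_apply_zero, crossL_apply_one,
      crossL_apply_two, PiLp.smul_apply, PiLp.sub_apply, smul_eq_mul] <;> ring
  have hw := H.convex x hx _ (crossL_combination_ne_zero h (s := -⟪P u, P v⟫_ℝ)
    (t := ⟪P u, P u⟫_ℝ) (Or.inr (inner_self_pos_of_ne hPu).ne'))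
  have hz : fderiv ℝ R x (-⟪P u, P v⟫_ℝ • u + ⟪P u, P u⟫_ℝ • v) = 0 := by
    change P _ = 0
    rw [map_add, map_smul, map_smul, neg_smul, neg_add_eq_sub, e, h0]
    simp
  rw [hz, inner_zero_right] at hw
  exact lt_irrefl _ hw

/-- Differentiating `⟪N, V⟫ = 0`. -/
theorem inner_fderiv_of_tangent {V : E3 → E3} {x : E3} (hx : x ≠ 0) (hV : ContDiffAt ℝ ∞ V x)
    (h : ∀ y ≠ 0, ⟪N y, V y⟫_ℝ = 0) (u : E3) :
    ⟪N x, fderiv ℝ V x u⟫_ℝ = -⟪fderiv ℝ N x u, V x⟫_ℝ := by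
  have hd := (hasFDerivAt_of_contDiffAt (H.smooth_normal x hx)).inner ℝ (hasFDerivAt_of_contDiffAt hV)
  have h0 : HasFDerivAt (fun y => ⟪N y, V y⟫_ℝ) (0 : E3 →L[ℝ] ℝ) x := by
    refine (hasFDerivAt_const (0 : ℝ) x).congr_of_eventuallyEq ?_
    filter_upwards [isOpen_ne.mem_nhds hx] with y hy using h y hy
  have := DFunLike.congr_fun (hd.unique h0) u
  simp at this
  linarith

/-- Both sides equal `-⟪N, D²R(u, v)⟫`. -/
theorem second_fundamental_form_symm {x : E3} (hx : x ≠ 0) (u v : E3) :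
    ⟪fderiv ℝ N x u, fderiv ℝ R x v⟫_ℝ = ⟪fderiv ℝ N x v, fderiv ℝ R x u⟫_ℝ := by
  have h1 := H.inner_fderiv_of_tangent hx (contDiffAt_fderiv_apply (H.smooth x hx) v)
    (fun y hy => H.normal y hy v) u
  have h2 := H.inner_fderiv_of_tangent hx (contDiffAt_fderiv_apply (H.smooth x hx) u)
    (fun y hy => H.normal y hy u) v
  rw [fderiv_fderiv_apply_comm (H.smooth x hx)] at h1
  linarith

theorem second_fundamental_form_det {x : E3} (hx : x ≠ 0) {u v : E3}
    (h : ⟪x, crossL u v⟫_ℝ ≠ 0) :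
    ⟪fderiv ℝ N x u, fderiv ℝ R x v⟫_ℝ ^ 2 <
      ⟪fderiv ℝ N x u, fderiv ℝ R x u⟫_ℝ * ⟪fderiv ℝ N x v, fderiv ℝ R x v⟫_ℝ := by
  have hL := H.convex x hx u (by
    simpa using crossL_combination_ne_zero h (s := 1) (t := 0) (by simp))
  have hs := H.second_fundamental_form_symm hx u v
  -- With entries `L`, `M`, `K`, the form takes the value `L (L K - M²)` on `-M u + L v`.
  have hw := H.convex x hx _ (crossL_combination_ne_zero h
    (s := -⟪fderiv ℝ N x u, fderiv ℝ R x v⟫_ℝ) (t := ⟪fderiv ℝ N x u, fderiv ℝ R x u⟫_ℝ)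
    (Or.inr hL.ne'))
  simp only [map_add, map_smul, inner_add_left, inner_add_right, inner_smul_left,
    inner_smul_right, conj_trivial] at hw
  rw [← hs] at hw
  by_contra! hc
  nlinarith

/-- A vector orthogonal to the tangent plane is a multiple of the normal. -/
theorem eq_smul_normal {x : E3} (hx : x ≠ 0) {w : E3}
    (h : ∀ v, ⟪w, fderiv ℝ R x v⟫_ℝ = 0) : w = ⟪w, N x⟫_ℝ • N x := by
  obtain ⟨u, v, huv⟩ := exists_complementary_pair hx
  have hm := H.cross_ne_zero hx huv
  set a := fderiv ℝ R x u
  set b := fderiv ℝ R x v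
  rw [← sub_eq_zero]
  set z := w - ⟪w, N x⟫_ℝ • N x with hz
  have hza : ⟪z, a⟫_ℝ = 0 := by
    rw [hz, inner_sub_left, inner_smul_left, h u, H.normal x hx]; simp
  have hzb : ⟪z, b⟫_ℝ = 0 := by
    rw [hz, inner_sub_left, inner_smul_left, h v, H.normal x hx]; simp
  have hzn : ⟪z, N x⟫_ℝ = 0 := by
    rw [hz, inner_sub_left, inner_smul_left, H.unit x hx]; simp
  have hN := crossL_decomposition a b (N x)
  have h1 : ⟪crossL (N x) b, crossL a b⟫_ℝ = 0 := by
    have e : ⟪crossL (N x) b, crossL a b⟫_ℝ =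
        ⟪N x, a⟫_ℝ * ⟪b, b⟫_ℝ - ⟪N x, b⟫_ℝ * ⟪a, b⟫_ℝ := by
      simp only [inner_eq_coord, crossL_apply_zero, crossL_apply_one, crossL_apply_two]; ring
    rw [e, H.normal x hx, H.normal x hx]; ring
  have h2 : ⟪crossL a (N x), crossL a b⟫_ℝ = 0 := by
    have e : ⟪crossL a (N x), crossL a b⟫_ℝ =
        ⟪N x, b⟫_ℝ * ⟪a, a⟫_ℝ - ⟪N x, a⟫_ℝ * ⟪a, b⟫_ℝ := by
      simp only [inner_eq_coord, crossL_apply_zero, crossL_apply_one, crossL_apply_two]; ring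
    rw [e, H.normal x hx, H.normal x hx]; ring
  rw [h1, h2, zero_smul, zero_smul, zero_add, zero_add] at hN
  have h3 : ⟪N x, crossL a b⟫_ℝ ≠ 0 := by
    intro h0
    rw [h0, zero_smul] at hN
    have hN0 := (smul_eq_zero.1 hN).resolve_left (inner_self_pos_of_ne hm).ne'
    have := H.unit x hx
    rw [hN0, inner_zero_left] at this
    exact zero_ne_one this
  refine eq_zero_of_inner_frame hm hza hzb ?_
  have h4 := congrArg (fun y => ⟪z, y⟫_ℝ) hN
  simp only [inner_smul_right, hzn, mul_zero] at h4
  exact (mul_eq_zero.1 h4.symm).resolve_left h3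

end IsConvexImmersion

/-- The derivatives `c`, `d` of a rotation field along tangent vectors `a`, `b` of a convex surface
satisfy `c × d = k (a × b)` with `k ≤ 0`, and `k = 0` only if they vanish. -/
theorem crossL_eq_nonpos_smul {a b c d s t : E3} (hm : crossL a b ≠ 0)
    (hcd : crossL c b = crossL d a) (hM : ⟪s, b⟫_ℝ = ⟪t, a⟫_ℝ) (hsd : ⟪s, d⟫_ℝ = ⟪t, c⟫_ℝ)
    (hL : 0 < ⟪s, a⟫_ℝ) (hdet : ⟪s, b⟫_ℝ ^ 2 < ⟪s, a⟫_ℝ * ⟪t, b⟫_ℝ) :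
    ∃ k : ℝ, k ≤ 0 ∧ crossL c d = k • crossL a b ∧ (k = 0 → c = 0 ∧ d = 0) := by
  have hc : ⟪c, crossL a b⟫_ℝ = 0 := by
    rw [← inner_crossL_cyclic, ← inner_crossL_cyclic, crossL_anticomm b c, hcd, inner_neg_right,
      inner_crossL_right, neg_zero]
  have hd : ⟪d, crossL a b⟫_ℝ = 0 := by
    rw [inner_crossL_cyclic, inner_crossL_cyclic, ← hcd, inner_crossL_right]
  obtain ⟨α, β, rfl⟩ := exists_combination hm hc
  obtain ⟨γ, δ, rfl⟩ := exists_combination hm hd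
  have hδ : δ = -α := by
    have : (α + δ) • crossL a b = 0 := by
      have e : (α + δ) • crossL a b =
          crossL (α • a + β • b) b - crossL (γ • a + δ • b) a := by
        apply E3_ext <;> simp <;> ring
      rw [e, hcd, sub_self]
    linarith [(smul_eq_zero.1 this).resolve_right hm]
  subst hδ
  simp only [inner_add_right, inner_smul_right] at hsd
  set L := ⟪s, a⟫_ℝ
  set M := ⟪s, b⟫_ℝ
  set K := ⟪t, b⟫_ℝ
  rw [← hM] at hsd
  have hLK : 0 < L * K := lt_of_le_of_lt (sq_nonneg M) hdet
  have hK : 0 < K := pos_of_mul_pos_right hLK hL.le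
  -- The map `a ↦ c`, `b ↦ d` is trace-free by `hcd` and self-adjoint for the positive definite form
  -- `(L, M, K)` by `hsd`. Its eigenvalues are therefore `±λ` with `λ` real, and its determinant
  -- `-(α² + βγ)` is `-λ²`; this identity exhibits the sign.
  have key : 4 * (L * K) * (α ^ 2 + β * γ) =
      (γ * L + β * K) ^ 2 + 4 * α ^ 2 * (L * K - M ^ 2) := by
    have e : γ * L - β * K = 2 * α * M := by linarith
    have e2 : (γ * L - β * K) ^ 2 = (2 * α * M) ^ 2 := by rw [e]
    linarith
  refine ⟨-(α ^ 2 + β * γ), ?_, ?_, ?_⟩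
  · have h1 : 0 ≤ 4 * (L * K) * (α ^ 2 + β * γ) := by
      rw [key]
      have := sub_pos.2 hdet
      positivity
    have := nonneg_of_mul_nonneg_right h1 (by positivity)
    linarith
  · apply E3_ext <;> simp <;> ring
  · intro h0
    have h1 : α ^ 2 + β * γ = 0 := by linarith
    rw [h1, mul_zero] at key
    have hp := sub_pos.2 hdet
    have h2 : 4 * α ^ 2 * (L * K - M ^ 2) = 0 :=
      le_antisymm (by nlinarith [sq_nonneg (γ * L + β * K)]) (by positivity)
    have h3 : α = 0 := by
      have := (mul_eq_zero.1 h2).resolve_right hp.ne'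
      simpa using this
    subst h3
    have h4 : γ * L + β * K = 0 := by
      have : (γ * L + β * K) ^ 2 = 0 := by linarith
      simpa using this
    have h5 : γ * L - β * K = 0 := by linarith
    have h6 : γ = 0 := by
      have : γ * L = 0 := by linarith
      exact (mul_eq_zero.1 this).resolve_right hL.ne'
    have h7 : β = 0 := by
      have : β * K = 0 := by linarith
      exact (mul_eq_zero.1 this).resolve_right hK.ne'
    simp [h6, h7]

/-! ### Local homeomorphisms of the sphere are injective -/

theorem one_lt_rank_E3 : 1 < Module.rank ℝ E3 :=
  Module.one_lt_rank_of_one_lt_finrank (by simp)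

theorem one_lt_rank_orthogonal (v : S2) : 1 < Module.rank ℝ (ℝ ∙ (v : E3))ᗮ := by
  have : Fact (Module.finrank ℝ E3 = 2 + 1) := ⟨by simp⟩
  apply Module.one_lt_rank_of_one_lt_finrank
  rw [Submodule.finrank_orthogonal_span_singleton (n := 2) (ne_zero_of_mem_unit_sphere v)]
  norm_num

/-- Stereographic projection from a point of `S` turns the complement into a plane minus a countable
set. -/
theorem isPreconnected_compl_of_finite {S : Set S2} (hS : S.Finite) : IsPreconnected Sᶜ := by
  rcases S.eq_empty_or_nonempty with rfl | ⟨v, hv⟩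
  · have := isPreconnected_sphere one_lt_rank_E3 (0 : E3) 1
    rw [Set.compl_empty]
    exact (isPreconnected_iff_preconnectedSpace.1 this).isPreconnected_univ
  · set f := (stereographic (norm_eq_of_mem_sphere v)).symm
    have hemb : Topology.IsOpenEmbedding f := isOpenEmbedding_stereographic_symm _
    have hr : Set.range f = {v}ᶜ := range_stereographic_symm _ v.2
    have hc : IsPreconnected (f ⁻¹' S)ᶜ :=
      ((hS.preimage hemb.injective.injOn).countable.isConnected_compl_of_one_lt_rank
        (one_lt_rank_orthogonal v)).isPreconnected
    have himg : f '' (f ⁻¹' S)ᶜ = Sᶜ := by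
      rw [← Set.preimage_compl, Set.image_preimage_eq_inter_range, hr, Set.inter_eq_left]
      exact Set.compl_subset_compl.2 (Set.singleton_subset_iff.2 hv)
    rw [← himg]
    exact hc.image _ hemb.continuous.continuousOn

/-- By compactness `n` is a covering with finite fibres. The sphere minus a point `v` is a simply
connected plane, so its inclusion `f` lifts through `n`. Images of lifts are open, distinct lifts
have disjoint images, and together they cover the complement of the fibre over `v`. That complement
is connected, so a single lift fills it, and `n` is injective there. -/
theorem injective_of_isLocalHomeomorph {n : S2 → S2} (hn : IsLocalHomeomorph n) :
    Function.Injective n := by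
  have cov : IsCoveringMap n := isLocalHomeomorph_iff_isCoveringMap.1 hn
  intro p q hpq
  have : Nontrivial S2 := by
    refine ⟨⟨p, -p, fun h => ?_⟩⟩
    have h1 : (p : E3) = -(p : E3) := congrArg Subtype.val h
    have h2 := ne_zero_of_mem_unit_sphere p
    have h3 : (2 : ℝ) • (p : E3) = 0 := by rw [two_smul]; nth_rewrite 2 [h1]; exact add_neg_cancel _
    exact h2 ((smul_eq_zero.1 h3).resolve_left two_ne_zero)
  obtain ⟨v, hv⟩ := exists_ne (n p)
  set f := (stereographic (norm_eq_of_mem_sphere v)).symm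
  have hemb : Topology.IsOpenEmbedding f := isOpenEmbedding_stereographic_symm _
  have hr : Set.range f = {v}ᶜ := range_stereographic_symm _ v.2
  have : SimplyConnectedSpace (ℝ ∙ (v : E3))ᗮ := inferInstance
  let fc : C((ℝ ∙ (v : E3))ᗮ, S2) := ⟨f, hemb.continuous⟩
  have hsurj (x : S2) (hx : n x ≠ v) : ∃ a, f a = n x := by
    have : n x ∈ Set.range f := by rw [hr]; exact hx
    exact this
  have hlift (x : S2) (hx : n x ≠ v) : ∃ F : C((ℝ ∙ (v : E3))ᗮ, S2), n ∘ F = f ∧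
      x ∈ Set.range F := by
    obtain ⟨a, ha⟩ := hsurj x hx
    obtain ⟨F, ⟨h1, h2⟩, -⟩ := cov.existsUnique_continuousMap_lifts fc a x ha.symm
    exact ⟨F, h2, a, h1⟩
  have hopen (F : C((ℝ ∙ (v : E3))ᗮ, S2)) (hF : n ∘ F = f) : IsOpen (Set.range F) :=
    (hn.isOpenEmbedding_of_comp (hF ▸ hemb) F.continuous).isOpen_range
  obtain ⟨F, hF, a, ha⟩ := hlift p hv.symm
  have hfin : (n ⁻¹' {v}).Finite := by
    have hcl : IsClosed (n ⁻¹' {v}) := isClosed_singleton.preimage hn.continuous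
    have := (cov v).discreteTopology_fiber
    exact hcl.isCompact.finite (isDiscrete_iff_discreteTopology.2 this)
  have hcon := isPreconnected_compl_of_finite hfin
  set V : Set S2 := ⋃ G : {G : C((ℝ ∙ (v : E3))ᗮ, S2) // n ∘ G = f ∧ G ≠ F}, Set.range G.1
  have hV : IsOpen V := isOpen_iUnion fun G => hopen G.1 G.2.1
  have hcover : (n ⁻¹' {v})ᶜ ⊆ Set.range F ∪ V := by
    intro x hx
    obtain ⟨G, hG, hxG⟩ := hlift x hx
    by_cases hGF : G = F
    · exact Or.inl (hGF ▸ hxG)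
    · exact Or.inr (Set.mem_iUnion.2 ⟨⟨G, hG, hGF⟩, hxG⟩)
  have hdisj : Set.range F ∩ V = ∅ := by
    rw [Set.eq_empty_iff_forall_notMem]
    rintro x ⟨⟨b, rfl⟩, hx⟩
    obtain ⟨⟨G, hG, hne⟩, c, hc⟩ := Set.mem_iUnion.1 hx
    have hbc : f c = f b := by
      rw [← congrFun hG c, ← congrFun hF b, Function.comp_apply, Function.comp_apply, hc]
    have hcb := hemb.injective hbc
    subst hcb
    exact hne (DFunLike.coe_injective (cov.eq_of_comp_eq G.continuous F.continuous
      (hG.trans hF.symm) c hc))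
  have hsub : (n ⁻¹' {v})ᶜ ⊆ Set.range F := by
    refine hcon.subset_left_of_subset_union (hopen F hF) hV (Set.disjoint_iff_inter_eq_empty.2 hdisj)
      hcover ⟨p, fun h => hv h.symm, a, ha⟩
  obtain ⟨b, hb⟩ := hsub (show q ∈ (n ⁻¹' {v})ᶜ from fun h => hv (hpq.trans h).symm)
  have : f a = f b := by
    rw [← congrFun hF a, ← congrFun hF b, Function.comp_apply, Function.comp_apply, ha, hb, hpq]
  rw [← ha, ← hb, hemb.injective this]

/-! ### The Gauss map of a convex immersion and its support function -/

/-- The radial projection to the sphere, with a junk value at the origin. -/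
def sphereProj (x : E3) : S2 :=
  if h : x = 0 then ⟨EuclideanSpace.single 0 1, by simp⟩
  else ⟨‖x‖⁻¹ • x, by simp [norm_smul, inv_mul_cancel₀ (norm_ne_zero_iff.2 h)]⟩

theorem coe_sphereProj {x : E3} (hx : x ≠ 0) : (sphereProj x : E3) = ‖x‖⁻¹ • x := by
  simp [sphereProj, hx]

theorem sphereProj_coe (p : S2) : sphereProj (p : E3) = p := by
  apply Subtype.ext
  rw [coe_sphereProj (ne_zero_of_mem_unit_sphere p)]
  simp

theorem sphereProj_smul {x : E3} (hx : x ≠ 0) {t : ℝ} (ht : 0 < t) :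
    sphereProj (t • x) = sphereProj x := by
  apply Subtype.ext
  rw [coe_sphereProj hx, coe_sphereProj (smul_ne_zero ht.ne' hx), norm_smul, Real.norm_of_nonneg ht.le,
    smul_smul, mul_inv_rev, inv_mul_cancel_right₀ ht.ne']

theorem continuousAt_sphereProj {x : E3} (hx : x ≠ 0) : ContinuousAt sphereProj x := by
  rw [Topology.IsInducing.subtypeVal.continuousAt_iff]
  have : ContinuousAt (fun y : E3 => ‖y‖⁻¹ • y) x :=
    (continuous_norm.continuousAt.inv₀ (norm_ne_zero_iff.2 hx)).smul continuousAt_id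
  refine this.congr ?_
  filter_upwards [isOpen_ne.mem_nhds hx] with y hy using (coe_sphereProj hy).symm

/-- The inclusion of the sphere is a continuous section, which gives openness of the projection at
unit vectors. -/
theorem map_sphereProj_nhds {x : E3} (hx : ‖x‖ = 1) :
    Filter.map sphereProj (nhds x) = nhds (sphereProj x) := by
  have hx0 : x ≠ 0 := by rintro rfl; simp at hx
  refine le_antisymm (continuousAt_sphereProj hx0) ?_
  obtain ⟨p, rfl⟩ : ∃ p : S2, (p : E3) = x := ⟨⟨x, by simpa using hx⟩, rfl⟩
  rw [sphereProj_coe]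
  calc nhds p = Filter.map sphereProj (Filter.map Subtype.val (nhds p)) := by
        rw [Filter.map_map]
        have : sphereProj ∘ (Subtype.val : S2 → E3) = id := funext sphereProj_coe
        rw [this, Filter.map_id]
    _ ≤ _ := Filter.map_mono continuous_subtype_val.continuousAt

namespace IsConvexImmersion

variable {R N : E3 → E3} (H : IsConvexImmersion R N)
include H

theorem norm_normal {x : E3} (hx : x ≠ 0) : ‖N x‖ = 1 := by
  have := H.unit x hx
  rw [real_inner_self_eq_norm_sq] at this
  nlinarith [norm_nonneg (N x)]

theorem apply_sphereProj {x : E3} (hx : x ≠ 0) : R (sphereProj x) = R x := by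
  rw [coe_sphereProj hx]
  exact H.radial x hx _ (by positivity)

theorem normal_sphereProj {x : E3} (hx : x ≠ 0) : N (sphereProj x) = N x := by
  rw [coe_sphereProj hx]
  exact H.radial_normal x hx _ (by positivity)

/-- The degree-one homogeneous extension of the Gauss map allows the inverse function theorem to be
used in `E3` without charts. Its derivative `v ↦ dN v + ⟪p, v⟫ N` is injective: the normal component
gives `⟪p, v⟫ = 0`, then `dN v = 0`, so `v` is radial by convexity. -/
theorem hasStrictFDerivAt_norm_smul_normal (p : S2) : ∃ e : E3 ≃L[ℝ] E3,
    HasStrictFDerivAt (fun x : E3 => ‖x‖ • N x) (e : E3 →L[ℝ] E3) (p : E3) := by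
  have hp := ne_zero_of_mem_unit_sphere p
  have hn : ‖(p : E3)‖ = 1 := norm_eq_of_mem_sphere p
  have hs : ContDiffAt ℝ ∞ (fun x : E3 => ‖x‖ • N x) p :=
    (contDiffAt_norm ℝ hp).smul (H.smooth_normal p hp)
  have hstrict := hs.hasStrictFDerivAt (by simp)
  set F := fderiv ℝ (fun x : E3 => ‖x‖ • N x) p
  have hF (v : E3) : F v = fderiv ℝ N p v + ⟪(p : E3), v⟫_ℝ • N p := by
    have h1 : HasFDerivAt (fun x : E3 => ‖x‖) (innerSL ℝ (p : E3)) (p : E3) := by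
      have h2 := ((contDiffAt_norm ℝ hp (n := 1)).differentiableAt (by simp)).hasFDerivAt
      have h3 := h2.pow 2
      have h4 := h3.unique (hasStrictFDerivAt_norm_sq (p : E3)).hasFDerivAt
      have h5 : fderiv ℝ (fun x : E3 => ‖x‖) (p : E3) = innerSL ℝ (p : E3) := by
        ext1 v
        have := DFunLike.congr_fun h4 v
        simp [hn] at this
        simpa using this
      rw [← h5]
      exact h2
    have h2 := h1.smul (hasFDerivAt_of_contDiffAt (H.smooth_normal p hp))
    have h3 : F = _ := h2.fderiv
    rw [h3]
    simp [hn]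
  have hNN (v : E3) : ⟪N p, fderiv ℝ N p v⟫_ℝ = 0 := by
    have h1 := (hasFDerivAt_of_contDiffAt (H.smooth_normal p hp)).inner ℝ
      (hasFDerivAt_of_contDiffAt (H.smooth_normal p hp))
    have h0 : HasFDerivAt (fun y => ⟪N y, N y⟫_ℝ) (0 : E3 →L[ℝ] ℝ) (p : E3) := by
      refine (hasFDerivAt_const (1 : ℝ) (p : E3)).congr_of_eventuallyEq ?_
      filter_upwards [isOpen_ne.mem_nhds hp] with y hy using H.unit y hy
    have := DFunLike.congr_fun (h1.unique h0) v
    simp [real_inner_comm] at this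
    exact this
  have hinj : Function.Injective F.toLinearMap := by
    rw [← LinearMap.ker_eq_bot, LinearMap.ker_eq_bot']
    intro v hv
    have hv' : fderiv ℝ N p v + ⟪(p : E3), v⟫_ℝ • N p = 0 := by rw [← hF]; exact hv
    have h1 : ⟪(p : E3), v⟫_ℝ = 0 := by
      have := congrArg (fun w => ⟪N p, w⟫_ℝ) hv'
      simp only [inner_add_right, inner_smul_right, hNN, H.unit p hp, inner_zero_right] at this
      linarith
    rw [h1, zero_smul, add_zero] at hv'
    have h2 : crossL (p : E3) v = 0 := by
      by_contra h
      have := H.convex p hp v h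
      rw [hv', inner_zero_left] at this
      exact lt_irrefl _ this
    have h3 := norm_crossL_sq (p : E3) v
    rw [h2, h1, inner_zero_left, real_inner_self_eq_norm_sq (p : E3), hn] at h3
    have h4 : ⟪v, v⟫_ℝ = 0 := by linarith
    exact inner_self_eq_zero.1 h4
  refine ⟨(LinearEquiv.ofInjectiveEndo F.toLinearMap hinj).toContinuousLinearEquiv, ?_⟩
  have e : ((LinearEquiv.ofInjectiveEndo F.toLinearMap hinj).toContinuousLinearEquiv :
      E3 →L[ℝ] E3) = F := by
    ext1 v; rfl
  rw [e]
  exact hstrict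

/-- The Gauss map. -/
def gaussMap (p : S2) : S2 :=
  ⟨N p, by simpa using H.norm_normal (ne_zero_of_mem_unit_sphere p)⟩

theorem coe_gaussMap (p : S2) : (H.gaussMap p : E3) = N p := rfl

theorem continuous_gaussMap : Continuous H.gaussMap := by
  refine Continuous.subtype_mk ?_ _
  rw [continuous_iff_continuousAt]
  intro p
  exact (H.smooth_normal p (ne_zero_of_mem_unit_sphere p)).continuousAt.comp
    continuous_subtype_val.continuousAt

theorem sphereProj_norm_smul_normal {x : E3} (hx : x ≠ 0) :
    sphereProj (‖x‖ • N x) = H.gaussMap (sphereProj x) := by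
  have h1 := H.norm_normal hx
  have h2 : N x ≠ 0 := by rw [← norm_ne_zero_iff, h1]; exact one_ne_zero
  rw [sphereProj_smul h2 (norm_pos_iff.2 hx)]
  apply Subtype.ext
  rw [coe_sphereProj h2, h1, inv_one, one_smul, coe_gaussMap, H.normal_sphereProj hx]

theorem isOpenMap_gaussMap : IsOpenMap H.gaussMap := by
  refine IsOpenMap.of_nhds_le fun p => ?_
  have hp := ne_zero_of_mem_unit_sphere p
  have hn : ‖(p : E3)‖ = 1 := norm_eq_of_mem_sphere p
  obtain ⟨e, he⟩ := H.hasStrictFDerivAt_norm_smul_normal p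
  have h1 : Filter.map (fun x : E3 => ‖x‖ • N x) (nhds (p : E3)) = nhds (‖(p : E3)‖ • N p) :=
    he.map_nhds_eq_of_equiv
  have h2 : ‖‖(p : E3)‖ • N p‖ = 1 := by
    rw [norm_smul, H.norm_normal hp, norm_norm, hn, mul_one]
  have h3 := map_sphereProj_nhds h2
  have h4 := map_sphereProj_nhds hn
  rw [sphereProj_coe] at h4
  rw [← h1, H.sphereProj_norm_smul_normal hp, sphereProj_coe, Filter.map_map] at h3
  rw [← h3, ← h4, Filter.map_map]
  refine le_of_eq (Filter.map_congr ?_)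
  filter_upwards [isOpen_ne.mem_nhds hp] with x hx using H.sphereProj_norm_smul_normal hx

theorem isLocalHomeomorph_gaussMap : IsLocalHomeomorph H.gaussMap := by
  rw [isLocalHomeomorph_iff_isOpenEmbedding_restrict]
  intro p
  obtain ⟨e, he⟩ := H.hasStrictFDerivAt_norm_smul_normal p
  set W := he.toOpenPartialHomeomorph
  set U : Set S2 := Subtype.val ⁻¹' W.source
  have hU : IsOpen U := W.open_source.preimage continuous_subtype_val
  refine ⟨U, hU.mem_nhds he.mem_toOpenPartialHomeomorph_source, ?_⟩
  refine .of_continuous_injective_isOpenMap (H.continuous_gaussMap.comp continuous_subtype_val) ?_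
    (H.isOpenMap_gaussMap.comp hU.isOpenMap_subtype_val)
  rintro ⟨q, hq⟩ ⟨q', hq'⟩ h
  have h1 : N q = N q' := congrArg Subtype.val h
  apply Subtype.ext
  apply Subtype.ext
  refine W.injOn hq hq' ?_
  change ‖(q : E3)‖ • N q = ‖(q' : E3)‖ • N q'
  rw [norm_eq_of_mem_sphere, norm_eq_of_mem_sphere, h1]

theorem injective_gaussMap : Function.Injective H.gaussMap :=
  injective_of_isLocalHomeomorph H.isLocalHomeomorph_gaussMap

/-- At a maximum of a height function the direction is the outward normal. -/
theorem normal_eq_of_isLocalMax {x e : E3} (hx : x ≠ 0) (he : ‖e‖ = 1)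
    (hmax : IsLocalMax (fun y => ⟪e, R y⟫_ℝ) x) : N x = e := by
  have hder {y : E3} (hy : y ≠ 0) : HasFDerivAt (fun y => ⟪e, R y⟫_ℝ)
      (innerSL ℝ e ∘L fderiv ℝ R y) y :=
    (innerSL ℝ e).hasFDerivAt.comp y (hasFDerivAt_of_contDiffAt (H.smooth y hy))
  have hcrit : ∀ v, ⟪e, fderiv ℝ R x v⟫_ℝ = 0 := fun v => by
    have := DFunLike.congr_fun (hmax.hasFDerivAt_eq_zero (hder hx)) v
    simpa using this
  have hec := H.eq_smul_normal hx hcrit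
  set c := ⟪e, N x⟫_ℝ
  have hc1 : |c| = 1 := by
    have := congrArg norm hec
    rw [norm_smul, H.norm_normal hx, he, mul_one, Real.norm_eq_abs] at this
    exact this.symm
  rcases eq_or_eq_neg_of_abs_eq hc1 with h1 | h1
  · rw [hec, h1, one_smul]
  -- If `e = -N x`, the height has second derivative `⟪dN u, dR u⟫ > 0` along `u`, so it has a local
  -- minimum there as well.
  exfalso
  obtain ⟨u, v, huv⟩ := exists_complementary_pair hx
  have hu : crossL x u ≠ 0 := by
    simpa using crossL_combination_ne_zero huv (s := 1) (t := 0) (by simp)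
  set g : ℝ → ℝ := fun t => ⟪e, R (x + t • u)⟫_ℝ
  have hline (t : ℝ) : HasDerivAt (fun t : ℝ => x + t • u) u t := by
    simpa using ((hasDerivAt_id t).smul_const u).const_add x
  have hne : ∀ᶠ t : ℝ in nhds 0, x + t • u ≠ 0 := by
    refine (hline 0).continuousAt.eventually_ne ?_
    simpa using hx
  have hg1 : ∀ᶠ t : ℝ in nhds 0, deriv g t = ⟪e, fderiv ℝ R (x + t • u) u⟫_ℝ := by
    filter_upwards [hne] with t ht
    exact ((hder ht).comp_hasDerivAt t (hline t)).deriv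
  have hx0 : x + (0 : ℝ) • u = x := by simp
  have hg2 : HasDerivAt (deriv g) ⟪e, fderiv ℝ (fun y => fderiv ℝ R y u) x u⟫_ℝ 0 := by
    have h2 := hasFDerivAt_of_contDiffAt (contDiffAt_fderiv_apply (H.smooth x hx) u)
    have h3 := (innerSL ℝ e).hasFDerivAt.comp x h2
    rw [← hx0] at h3
    have h4 := h3.comp_hasDerivAt (0 : ℝ) (hline 0)
    rw [hx0] at h4
    exact h4.congr_of_eventuallyEq hg1
  have hpos : 0 < ⟪e, fderiv ℝ (fun y => fderiv ℝ R y u) x u⟫_ℝ := by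
    rw [hec, h1, inner_smul_left, H.inner_fderiv_of_tangent hx
      (contDiffAt_fderiv_apply (H.smooth x hx) u) (fun y hy => H.normal y hy u)]
    simpa using H.convex x hx u hu
  have hg0 : deriv g 0 = 0 := by rw [hg1.self_of_nhds, hx0, hcrit]
  have hgc : ContinuousAt g 0 := by
    have h3 := hder hx
    rw [← hx0] at h3
    exact (h3.comp_hasDerivAt (0 : ℝ) (hline 0)).continuousAt
  have hmin : IsLocalMin g 0 := isLocalMin_of_deriv_deriv_pos (by rw [hg2.deriv]; exact hpos) hg0 hgc
  have hmax' : ∀ᶠ t : ℝ in nhds 0, g t ≤ g 0 := by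
    have ht : Filter.Tendsto (fun t : ℝ => x + t • u) (nhds 0) (nhds x) := by
      have := (hline 0).continuousAt.tendsto
      rwa [hx0] at this
    filter_upwards [ht.eventually hmax] with t ht
    simpa [g] using ht
  -- Being both a local maximum and a local minimum makes `g` locally constant, against `g'' > 0`.
  have hconst : g =ᶠ[nhds 0] fun _ => g 0 := by
    filter_upwards [hmin, hmax'] with t h h' using le_antisymm h' h
  have h5 : deriv g =ᶠ[nhds 0] fun _ => 0 := by
    filter_upwards [hconst.deriv] with t ht
    rw [ht, deriv_const]
  have h6 : deriv (deriv g) 0 = 0 := by rw [h5.deriv_eq, deriv_const]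
  rw [hg2.deriv] at h6
  exact hpos.ne' h6

/-- Hadamard's theorem: a locally convex closed surface lies strictly on the inner side of each
of its tangent planes. -/
theorem support_pos {x y : E3} (hx : x ≠ 0) (hy : y ≠ 0) (hxy : sphereProj y ≠ sphereProj x) :
    0 < ⟪R x - R y, N x⟫_ℝ := by
  set e := N x
  have he : ‖e‖ = 1 := H.norm_normal hx
  set g : S2 → ℝ := fun p => ⟪e, R p⟫_ℝ
  have hg : Continuous g := by
    rw [continuous_iff_continuousAt]
    intro p
    refine continuousAt_const.inner ?_
    exact (H.smooth p (ne_zero_of_mem_unit_sphere p)).continuousAt.comp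
      continuous_subtype_val.continuousAt
  -- Every global maximum of the height in direction `e` has normal `e`, so injectivity of the Gauss
  -- map leaves only one.
  have key (p : S2) (hp : ∀ q, g q ≤ g p) : p = sphereProj x := by
    have hp0 := ne_zero_of_mem_unit_sphere p
    have hmax : IsLocalMax (fun y => ⟪e, R y⟫_ℝ) (p : E3) := by
      filter_upwards [isOpen_ne.mem_nhds hp0] with z hz
      rw [← H.apply_sphereProj hz]
      exact hp _
    have hN := H.normal_eq_of_isLocalMax hp0 he hmax
    apply H.injective_gaussMap
    apply Subtype.ext
    rw [coe_gaussMap, coe_gaussMap, hN, H.normal_sphereProj hx]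
  have : Nonempty S2 := ⟨sphereProj x⟩
  obtain ⟨p, -, hp⟩ := isCompact_univ.exists_isMaxOn Set.univ_nonempty hg.continuousOn
  have hp' : ∀ q, g q ≤ g p := fun q => hp (Set.mem_univ q)
  rw [key p hp'] at hp'
  have h1 : g (sphereProj y) < g (sphereProj x) := by
    refine lt_of_le_of_ne (hp' _) fun h => hxy (key _ fun q => ?_)
    rw [h]
    exact hp' q
  simp only [g, H.apply_sphereProj hx, H.apply_sphereProj hy] at h1
  rw [real_inner_comm, inner_sub_right]
  linarith

end IsConvexImmersion

/-! ### Stokes' theorem on the sphere -/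

theorem integral_fderiv_eq_zero {F : E3 → ℝ} (hF : ContDiff ℝ 1 F) (hc : HasCompactSupport F)
    (v : E3) : ∫ x, fderiv ℝ F x v = 0 := by
  have hcont : Continuous (fun x => fderiv ℝ F x v) :=
    (hF.continuous_fderiv one_ne_zero).clm_apply continuous_const
  have h := integral_mul_fderiv_eq_neg_fderiv_mul_of_integrable (μ := MeasureTheory.volume)
    (f := fun _ : E3 => (1 : ℝ)) (g := F) (v := v) (by simp)
    (by simpa using hcont.integrable_of_hasCompactSupport (hc.fderiv_apply ℝ v))
    (by simpa using hF.continuous.integrable_of_hasCompactSupport hc)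
    (fun x _ => differentiableAt_const _) (fun x _ => hF.differentiable one_ne_zero x)
  simpa using h

/-- `x · curl A`, the flux density of `dA` through spheres. -/
def fluxCurl (A : Fin 3 → E3 → ℝ) (x : E3) : ℝ :=
  x 0 * (fderiv ℝ (A 2) x (EuclideanSpace.single 1 1) - fderiv ℝ (A 1) x (EuclideanSpace.single 2 1)) +
  x 1 * (fderiv ℝ (A 0) x (EuclideanSpace.single 2 1) - fderiv ℝ (A 2) x (EuclideanSpace.single 0 1)) +
  x 2 * (fderiv ℝ (A 1) x (EuclideanSpace.single 0 1) - fderiv ℝ (A 0) x (EuclideanSpace.single 1 1))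

theorem fderiv_cutoff_mul {φ : E3 → ℝ} {A : Fin 3 → E3 → ℝ} {x : E3}
    {d : ℝ} (hφ : HasFDerivAt φ (d • innerSL ℝ x) x)
    (hA : ∀ i, HasFDerivAt (A i) (fderiv ℝ (A i) x) x) (j k : Fin 3) (v : E3) :
    fderiv ℝ (fun y => φ y * (y j * A k y - y k * A j y)) x v =
      φ x * ((x j * fderiv ℝ (A k) x v + A k x * v j) - (x k * fderiv ℝ (A j) x v + A j x * v k)) +
        (x j * A k x - x k * A j x) * (d * ⟪x, v⟫_ℝ) := by
  have hp (i : Fin 3) : HasFDerivAt (fun y : E3 => y i) (EuclideanSpace.proj i : E3 →L[ℝ] ℝ) x :=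
    (EuclideanSpace.proj i : E3 →L[ℝ] ℝ).hasFDerivAt
  have h := hφ.mul (((hp j).mul (hA k)).sub ((hp k).mul (hA j)))
  have h' : fderiv ℝ (fun y => φ y * (y j * A k y - y k * A j y)) x = _ := h.fderiv
  rw [h']
  simp

/-- If the flux density of an exact two-form has a sign, then it vanishes. -/
theorem fluxCurl_eq_zero_of_nonneg {A : Fin 3 → E3 → ℝ}
    (hA : ∀ i, ∀ x ≠ 0, ContDiffAt ℝ ∞ (A i) x) (hpos : ∀ x ≠ 0, 0 ≤ fluxCurl A x) {x₀ : E3}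
    (hx₀ : x₀ ≠ 0) : fluxCurl A x₀ = 0 := by
  have hc : 0 < ‖x₀‖ ^ 2 := by positivity
  set c := ‖x₀‖ ^ 2
  -- A bump in the variable `‖x‖²`, centred at `‖x₀‖²`: `φ` is radial, equals `1` at `x₀`, and
  -- vanishes near the origin because `c / 2 < c`.
  let b : ContDiffBump c := ⟨c / 4, c / 2, by positivity, by linarith⟩
  set φ : E3 → ℝ := fun x => b (‖x‖ ^ 2)
  have hφs : ContDiff ℝ ∞ φ := b.contDiff.comp (contDiff_norm_sq ℝ)
  have hφd (x : E3) : HasFDerivAt φ ((deriv b (‖x‖ ^ 2) * 2) • innerSL ℝ x) x := by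
    have h1 : HasDerivAt b (deriv b (‖x‖ ^ 2)) (‖x‖ ^ 2) :=
      ((b.contDiff (n := 1)).differentiable one_ne_zero _).hasDerivAt
    have h2 := h1.comp_hasFDerivAt x (hasStrictFDerivAt_norm_sq x).hasFDerivAt
    have e : (2 : ℝ) • innerSL ℝ x = (2 : ℕ) • innerSL ℝ x := by rw [two_smul, two_nsmul]
    rw [mul_smul, e]
    exact h2
  have hφc : HasCompactSupport φ := by
    refine HasCompactSupport.intro (isCompact_closedBall (0 : E3) (2 * ‖x₀‖)) fun x hx => ?_
    apply b.zero_of_le_dist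
    have h1 : 2 * ‖x₀‖ < ‖x‖ := by simpa using hx
    have h2 : 4 * c ≤ ‖x‖ ^ 2 := by
      change 4 * ‖x₀‖ ^ 2 ≤ _
      nlinarith [norm_nonneg x₀, norm_nonneg x]
    change c / 2 ≤ _
    rw [Real.dist_eq]
    exact le_trans (by linarith) (le_abs_self _)
  have hφ0 : φ =ᶠ[nhds 0] 0 := by
    have : ∀ᶠ x : E3 in nhds 0, ‖x‖ ^ 2 < c / 2 := by
      have h : ContinuousAt (fun x : E3 => ‖x‖ ^ 2) 0 := by fun_prop
      exact h.eventually (gt_mem_nhds (by simpa using hc))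
    filter_upwards [this] with x hx
    apply b.zero_of_le_dist
    change c / 2 ≤ _
    rw [dist_comm, Real.dist_eq]
    exact le_trans (by linarith) (le_abs_self _)
  set F : Fin 3 → Fin 3 → E3 → ℝ := fun j k y => φ y * (y j * A k y - y k * A j y)
  have hFs (j k : Fin 3) : ContDiff ℝ 1 (F j k) := by
    rw [contDiff_iff_contDiffAt]
    intro x
    by_cases hx : x = 0
    · subst hx
      have : F j k =ᶠ[nhds 0] fun _ => (0 : ℝ) := by
        filter_upwards [hφ0] with y hy
        simp only [F, hy, Pi.zero_apply, zero_mul]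
      exact contDiffAt_const.congr_of_eventuallyEq this
    · have hp (i : Fin 3) : ContDiffAt ℝ 1 (fun y : E3 => y i) x :=
        (EuclideanSpace.proj i : E3 →L[ℝ] ℝ).contDiff.contDiffAt
      have ha (i : Fin 3) : ContDiffAt ℝ 1 (A i) x := (hA i x hx).of_le (by simp)
      exact (hφs.contDiffAt.of_le (by simp)).mul (((hp j).mul (ha k)).sub ((hp k).mul (ha j)))
  have hFc (j k : Fin 3) : HasCompactSupport (F j k) := hφc.mul_right
  have hDc (j k : Fin 3) (v : E3) : Continuous (fun x => fderiv ℝ (F j k) x v) :=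
    ((hFs j k).continuous_fderiv one_ne_zero).clm_apply continuous_const
  have hDi (j k : Fin 3) (v : E3) : MeasureTheory.Integrable (fun x => fderiv ℝ (F j k) x v) :=
    (hDc j k v).integrable_of_hasCompactSupport ((hFc j k).fderiv_apply ℝ v)
  -- `V` is the divergence of `φ (A × x)`. As `∇φ` is radial and `curl x = 0`, it equals `φ x · curl
  -- A`.
  set V : E3 → ℝ := fun x => fderiv ℝ (F 2 1) x (EuclideanSpace.single 0 1) +
    fderiv ℝ (F 0 2) x (EuclideanSpace.single 1 1) + fderiv ℝ (F 1 0) x (EuclideanSpace.single 2 1)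
  have hVc : Continuous V := ((hDc _ _ _).add (hDc _ _ _)).add (hDc _ _ _)
  have hVi : ∫ x, V x = 0 := by
    have e1 := MeasureTheory.integral_add (hDi 2 1 (EuclideanSpace.single 0 1))
      (hDi 0 2 (EuclideanSpace.single 1 1))
    have e2 := MeasureTheory.integral_add ((hDi 2 1 (EuclideanSpace.single 0 1)).add
      (hDi 0 2 (EuclideanSpace.single 1 1))) (hDi 1 0 (EuclideanSpace.single 2 1))
    simp only [Pi.add_apply] at e2
    simp only [V]
    rw [e2, e1, integral_fderiv_eq_zero (hFs _ _) (hFc _ _),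
      integral_fderiv_eq_zero (hFs _ _) (hFc _ _), integral_fderiv_eq_zero (hFs _ _) (hFc _ _)]
    simp
  have hV {x : E3} (hx : x ≠ 0) : V x = φ x * fluxCurl A x := by
    have hA' (i : Fin 3) := hasFDerivAt_of_contDiffAt (hA i x hx)
    simp only [V, F, fderiv_cutoff_mul (hφd x) hA', inner_eq_coord, fluxCurl]
    simp
    ring
  have hV0 : V 0 = 0 := by
    have : ∀ j k, fderiv ℝ (F j k) 0 = 0 := fun j k => by
      have : F j k =ᶠ[nhds 0] fun _ => (0 : ℝ) := by
        filter_upwards [hφ0] with y hy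
        simp only [F, hy, Pi.zero_apply, zero_mul]
      rw [this.fderiv_eq]
      simp
    simp [V, this]
  have hVn : 0 ≤ V := fun x => by
    by_cases hx : x = 0
    · rw [hx, hV0]; rfl
    · rw [hV hx]
      exact mul_nonneg b.nonneg (hpos x hx)
  have hVint : MeasureTheory.Integrable V := ((hDi _ _ _).add (hDi _ _ _)).add (hDi _ _ _)
  have hVz : V = 0 := by
    have := (MeasureTheory.integral_eq_zero_iff_of_nonneg hVn hVint).1 hVi
    exact (hVc.ae_eq_iff_eq MeasureTheory.volume continuous_zero).1 this
  have h1 : φ x₀ = 1 := b.one_of_mem_closedBall (by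
    change c ∈ _
    exact Metric.mem_closedBall_self b.rIn_pos.le)
  have h2 := hV hx₀
  rw [hVz, h1, one_mul] at h2
  exact h2.symm

/-! ### The rotation field of an infinitesimal deformation -/

/-- The solution `y` of `y × a = c`, `y × b = d`. -/
def rotationVector (a b c d : E3) : E3 :=
  (⟪crossL a b, crossL a b⟫_ℝ)⁻¹ •
    (⟪c, b⟫_ℝ • crossL a b + ⟪d, crossL a b⟫_ℝ • a - ⟪c, crossL a b⟫_ℝ • b)

/-- Pairing both equations with `a × b`, and the first with `b`, gives the coefficients of `y` in
the frame `a`, `b`, `a × b`. The three orthogonality hypotheses are the compatibility conditions for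
the remaining components. -/
theorem crossL_rotationVector {a b c d : E3} (hm : crossL a b ≠ 0) (hac : ⟪a, c⟫_ℝ = 0)
    (hbd : ⟪b, d⟫_ℝ = 0) (h : ⟪a, d⟫_ℝ + ⟪b, c⟫_ℝ = 0) :
    crossL (rotationVector a b c d) a = c ∧ crossL (rotationVector a b c d) b = d := by
  have hq := (inner_self_pos_of_ne hm).ne'
  have hcoord {z w : E3} : z = w ↔ ⟪crossL a b, crossL a b⟫_ℝ • (z - w) = 0 := by
    rw [smul_eq_zero, sub_eq_zero, or_iff_right hq]
  set Z := ⟪c, b⟫_ℝ • crossL a b + ⟪d, crossL a b⟫_ℝ • a - ⟪c, crossL a b⟫_ℝ • b with hZ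
  have hY (w : E3) : ⟪crossL a b, crossL a b⟫_ℝ • crossL (rotationVector a b c d) w =
      crossL Z w := by
    rw [rotationVector, map_smul, smul_apply, smul_smul, mul_inv_cancel₀ hq,
      one_smul]
  rw [hcoord, hcoord (w := d), smul_sub, smul_sub, hY, hY]
  constructor
  · refine eq_zero_of_inner_frame hm ?_ ?_ ?_
    · rw [inner_sub_left, inner_smul_left, real_inner_comm a c, hac, real_inner_comm,
        inner_crossL_right]
      simp
    · rw [hZ]
      simp only [inner_eq_coord, crossL_apply_zero, crossL_apply_one, crossL_apply_two,
        PiLp.smul_apply, PiLp.add_apply, PiLp.sub_apply, smul_eq_mul]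
      ring
    · rw [hZ]
      simp only [inner_eq_coord, crossL_apply_zero, crossL_apply_one, crossL_apply_two,
        PiLp.smul_apply, PiLp.add_apply, PiLp.sub_apply, smul_eq_mul]
      ring
  · refine eq_zero_of_inner_frame hm ?_ ?_ ?_
    · have e : ⟪crossL Z b - ⟪crossL a b, crossL a b⟫_ℝ • d, a⟫_ℝ =
          -(⟪crossL a b, crossL a b⟫_ℝ * (⟪a, d⟫_ℝ + ⟪b, c⟫_ℝ)) := by
        rw [hZ]
        simp only [inner_eq_coord, crossL_apply_zero, crossL_apply_one, crossL_apply_two,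
          PiLp.smul_apply, PiLp.add_apply, PiLp.sub_apply, smul_eq_mul]
        ring
      rw [e, h, mul_zero, neg_zero]
    · rw [inner_sub_left, inner_smul_left, real_inner_comm b d, hbd, real_inner_comm,
        inner_crossL_right]
      simp
    · rw [hZ]
      simp only [inner_eq_coord, crossL_apply_zero, crossL_apply_one, crossL_apply_two,
        PiLp.smul_apply, PiLp.add_apply, PiLp.sub_apply, smul_eq_mul]
      ring

theorem contDiffAt_crossL {f g : E3 → E3} {x : E3} (hf : ContDiffAt ℝ ∞ f x)
    (hg : ContDiffAt ℝ ∞ g x) : ContDiffAt ℝ ∞ (fun y => crossL (f y) (g y)) x :=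
  (crossL.contDiff.contDiffAt.comp x hf).clm_apply hg

theorem fderiv_crossL {f g : E3 → E3} {x : E3} (hf : ContDiffAt ℝ ∞ f x)
    (hg : ContDiffAt ℝ ∞ g x) (u : E3) : fderiv ℝ (fun y => crossL (f y) (g y)) x u =
      crossL (f x) (fderiv ℝ g x u) + crossL (fderiv ℝ f x u) (g x) := by
  have h := crossL.hasFDerivAt_of_bilinear (hasFDerivAt_of_contDiffAt hf)
    (hasFDerivAt_of_contDiffAt hg)
  rw [h.fderiv]
  simp

/-- An infinitesimal isometric deformation `T` of `R`, extended radially. -/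
structure IsEuclideanDeformation (R T : E3 → E3) : Prop where
  smooth : ∀ x ≠ 0, ContDiffAt ℝ ∞ T x
  radial : ∀ x ≠ 0, ∀ t : ℝ, 0 < t → T (t • x) = T x
  equation : ∀ x ≠ 0, ∀ u v,
    ⟪fderiv ℝ R x u, fderiv ℝ T x v⟫_ℝ + ⟪fderiv ℝ R x v, fderiv ℝ T x u⟫_ℝ = 0

namespace IsConvexImmersion

variable {R N : E3 → E3} (H : IsConvexImmersion R N)
include H

theorem exists_rotation_field {T : E3 → E3} (hT : IsEuclideanDeformation R T) :
    ∃ Y : E3 → E3, (∀ x ≠ 0, ContDiffAt ℝ ∞ Y x) ∧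
      ∀ x ≠ 0, ∀ v, fderiv ℝ T x v = crossL (Y x) (fderiv ℝ R x v) := by
  have hrot {x : E3} (hx : x ≠ 0) {u v : E3} (huv : ⟪x, crossL u v⟫_ℝ ≠ 0) (w : E3) :
      fderiv ℝ T x w = crossL (rotationVector (fderiv ℝ R x u) (fderiv ℝ R x v)
        (fderiv ℝ T x u) (fderiv ℝ T x v)) (fderiv ℝ R x w) := by
    have huu := hT.equation x hx u u
    have hvv := hT.equation x hx v v
    have h := crossL_rotationVector (H.cross_ne_zero hx huv)
      (c := fderiv ℝ T x u) (d := fderiv ℝ T x v) (by linarith) (by linarith)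
      (hT.equation x hx u v)
    set y := rotationVector (fderiv ℝ R x u) (fderiv ℝ R x v) (fderiv ℝ T x u) (fderiv ℝ T x v)
    have hTx : fderiv ℝ T x x = 0 :=
      fderiv_radial ((hT.smooth x hx).differentiableAt (by simp)) (hT.radial x hx)
    have hz : fderiv ℝ T x - crossL y ∘L fderiv ℝ R x = 0 := by
      refine clm_eq_zero_of_frame huv ?_ ?_ ?_
      · simp [hTx, H.fderiv_self hx]
      · simp [h.1]
      · simp [h.2]
    have := DFunLike.congr_fun hz w
    simpa [sub_eq_zero] using this
  have hex (x : E3) : ∃ y : E3, x ≠ 0 → ∀ v, fderiv ℝ T x v = crossL y (fderiv ℝ R x v) := by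
    by_cases hx : x = 0
    · exact ⟨0, fun h => (h hx).elim⟩
    · obtain ⟨u, v, huv⟩ := exists_complementary_pair hx
      exact ⟨_, fun _ => hrot hx huv⟩
  choose Y hY using hex
  refine ⟨Y, fun x hx => ?_, fun x hx => hY x hx⟩
  obtain ⟨u, v, huv⟩ := exists_complementary_pair hx
  have hnear : ∀ᶠ y in nhds x, ⟪y, crossL u v⟫_ℝ ≠ 0 := by
    have : ContinuousAt (fun y : E3 => ⟪y, crossL u v⟫_ℝ) x := by fun_prop
    exact this.eventually_ne huv
  -- The pointwise choice is smooth because uniqueness identifies it, near `x`, with the explicit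
  -- formula for one fixed pair.
  have heq : Y =ᶠ[nhds x] fun y => rotationVector (fderiv ℝ R y u) (fderiv ℝ R y v)
      (fderiv ℝ T y u) (fderiv ℝ T y v) := by
    filter_upwards [hnear, isOpen_ne.mem_nhds hx] with y hy hy0
    rw [← sub_eq_zero]
    refine eq_zero_of_crossL_frame (H.cross_ne_zero hy0 hy) ?_ ?_
    · rw [map_sub, sub_apply, ← hY y hy0, ← hrot hy0 hy, sub_self]
    · rw [map_sub, sub_apply, ← hY y hy0, ← hrot hy0 hy, sub_self]
  refine ContDiffAt.congr_of_eventuallyEq ?_ heq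
  have ha := contDiffAt_fderiv_apply (H.smooth x hx) u
  have hb := contDiffAt_fderiv_apply (H.smooth x hx) v
  have hc := contDiffAt_fderiv_apply (hT.smooth x hx) u
  have hd := contDiffAt_fderiv_apply (hT.smooth x hx) v
  have hm := contDiffAt_crossL ha hb
  exact ((hm.inner ℝ hm).inv (inner_self_pos_of_ne (H.cross_ne_zero hx huv)).ne').smul
    ((((hc.inner ℝ hb).smul hm).add ((hd.inner ℝ hm).smul ha)).sub ((hc.inner ℝ hm).smul hb))

/-- The integrability condition for the rotation field. -/
theorem crossL_fderiv_rotation_symm {T Y : E3 → E3} (hT : IsEuclideanDeformation R T)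
    (hY : ∀ x ≠ 0, ContDiffAt ℝ ∞ Y x)
    (hTY : ∀ x ≠ 0, ∀ v, fderiv ℝ T x v = crossL (Y x) (fderiv ℝ R x v)) {x : E3} (hx : x ≠ 0)
    (u v : E3) : crossL (fderiv ℝ Y x u) (fderiv ℝ R x v) =
      crossL (fderiv ℝ Y x v) (fderiv ℝ R x u) := by
  -- Differentiate `dT v = Y × dR v` along `u`; second derivatives of `T` and `R` are symmetric, so
  -- the remaining term is too.
  have h (u v : E3) : fderiv ℝ (fun y => fderiv ℝ T y v) x u =
      crossL (Y x) (fderiv ℝ (fun y => fderiv ℝ R y v) x u) +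
        crossL (fderiv ℝ Y x u) (fderiv ℝ R x v) := by
    rw [← fderiv_crossL (hY x hx) (contDiffAt_fderiv_apply (H.smooth x hx) v)]
    have : (fun y => fderiv ℝ T y v) =ᶠ[nhds x] fun y => crossL (Y y) (fderiv ℝ R y v) := by
      filter_upwards [isOpen_ne.mem_nhds hx] with y hy using hTY y hy v
    rw [this.fderiv_eq]
  have h1 := h u v
  rw [fderiv_fderiv_apply_comm (hT.smooth x hx), h v u,
    fderiv_fderiv_apply_comm (H.smooth x hx)] at h1
  exact (add_left_cancel h1).symm

end IsConvexImmersion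

/-- `Y` is a smooth field satisfying the integrability condition of rotation fields along `R`. -/
structure IsRotationField (R Y : E3 → E3) : Prop where
  smooth : ∀ x ≠ 0, ContDiffAt ℝ ∞ Y x
  symm : ∀ x ≠ 0, ∀ u v, crossL (fderiv ℝ Y x u) (fderiv ℝ R x v) =
    crossL (fderiv ℝ Y x v) (fderiv ℝ R x u)

/-! ### Constancy of rotation fields (Blaschke's integral argument). -/

namespace IsConvexImmersion

variable {R N : E3 → E3} (H : IsConvexImmersion R N) {Y : E3 → E3} (hY : IsRotationField R Y)
include H hY

theorem fderiv_rotation_self {x : E3} (hx : x ≠ 0) : fderiv ℝ Y x x = 0 := by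
  obtain ⟨u, v, huv⟩ := exists_complementary_pair hx
  refine eq_zero_of_crossL_frame (H.cross_ne_zero hx huv) ?_ ?_
  · rw [hY.symm x hx, H.fderiv_self hx, map_zero]
  · rw [hY.symm x hx, H.fderiv_self hx, map_zero]

/-- The trilinear form `⟪dR v, dY w × dR u⟫` is symmetric in `w, u` and skew in `u, v`, hence zero;
so `dY w` is tangent. -/
theorem inner_normal_fderiv_rotation {x : E3} (hx : x ≠ 0) (w : E3) :
    ⟪N x, fderiv ℝ Y x w⟫_ℝ = 0 := by
  obtain ⟨u, v, huv⟩ := exists_complementary_pair hx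
  have hswap (a b c : E3) : ⟪a, crossL b c⟫_ℝ = ⟪c, crossL a b⟫_ℝ := by
    rw [inner_crossL_cyclic, inner_crossL_cyclic]
  have hskew (a b c : E3) : ⟪c, crossL a b⟫_ℝ = -⟪b, crossL a c⟫_ℝ := by
    rw [inner_crossL_cyclic, crossL_anticomm b c, inner_neg_right, hswap]
  have h0 : ⟪fderiv ℝ Y x w, crossL (fderiv ℝ R x u) (fderiv ℝ R x v)⟫_ℝ = 0 := by
    have h1 : ⟪fderiv ℝ R x v, crossL (fderiv ℝ Y x w) (fderiv ℝ R x u)⟫_ℝ =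
        -⟪fderiv ℝ R x v, crossL (fderiv ℝ Y x w) (fderiv ℝ R x u)⟫_ℝ := by
      conv_lhs => rw [hY.symm x hx w u, hskew, hY.symm x hx u v, hskew, hY.symm x hx v w, neg_neg,
        hskew]
    rw [hswap]
    linarith
  obtain ⟨s, t, hst⟩ := exists_combination (H.cross_ne_zero hx huv) h0
  rw [hst, inner_add_right, inner_smul_right, inner_smul_right, H.normal x hx, H.normal x hx]
  simp

theorem fluxCross_rotation {x : E3} (hx : x ≠ 0) : ∃ k : ℝ, k ≤ 0 ∧
    fluxCross x (fderiv ℝ Y x) = k • fluxCross x (fderiv ℝ R x) ∧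
      (k = 0 → fderiv ℝ Y x = 0) := by
  obtain ⟨u, v, huv⟩ := exists_complementary_pair hx
  -- Both sides equal `-⟪N, D²Y(u, v)⟫`, from differentiating `⟪N, dY⟫ = 0`; this is the
  -- self-adjointness of `dY`.
  have hsd : ⟪fderiv ℝ N x u, fderiv ℝ Y x v⟫_ℝ = ⟪fderiv ℝ N x v, fderiv ℝ Y x u⟫_ℝ := by
    have h1 := H.inner_fderiv_of_tangent hx (contDiffAt_fderiv_apply (hY.smooth x hx) v)
      (fun y hy => H.inner_normal_fderiv_rotation hY hy v) u
    have h2 := H.inner_fderiv_of_tangent hx (contDiffAt_fderiv_apply (hY.smooth x hx) u)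
      (fun y hy => H.inner_normal_fderiv_rotation hY hy u) v
    rw [fderiv_fderiv_apply_comm (hY.smooth x hx)] at h1
    linarith
  obtain ⟨k, hk, hk1, hk2⟩ := crossL_eq_nonpos_smul (H.cross_ne_zero hx huv) (hY.symm x hx u v)
    (H.second_fundamental_form_symm hx u v) hsd
    (H.convex x hx u (by simpa using crossL_combination_ne_zero huv (s := 1) (t := 0) (by simp)))
    (H.second_fundamental_form_det hx huv)
  refine ⟨k, hk, ?_, fun h => ?_⟩
  · have h1 := fluxCross_eq (H.fderiv_rotation_self hY hx) u v
    rw [hk1, smul_comm, ← fluxCross_eq (H.fderiv_self hx) u v, smul_comm] at h1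
    exact smul_right_injective E3 huv h1
  · obtain ⟨h1, h2⟩ := hk2 h
    exact clm_eq_zero_of_frame huv (H.fderiv_rotation_self hY hx) h1 h2

omit hY in
theorem fluxCross_eq_smul_normal {x : E3} (hx : x ≠ 0) :
    fluxCross x (fderiv ℝ R x) = ⟪fluxCross x (fderiv ℝ R x), N x⟫_ℝ • N x := by
  refine H.eq_smul_normal hx fun w => ?_
  have key (a b c n : E3) (ha : ⟪n, a⟫_ℝ = 0) (hb : ⟪n, b⟫_ℝ = 0) (hc : ⟪n, c⟫_ℝ = 0)
      (hn : n ≠ 0) : ⟪crossL a b, c⟫_ℝ = 0 := by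
    have e : ⟪crossL a b, c⟫_ℝ • n =
        ⟪n, a⟫_ℝ • crossL b c + ⟪n, b⟫_ℝ • crossL c a + ⟪n, c⟫_ℝ • crossL a b := by
      apply E3_ext <;> simp [inner_eq_coord] <;> ring
    rw [ha, hb, hc] at e
    simp only [zero_smul, add_zero] at e
    exact (smul_eq_zero.1 e).resolve_right hn
  have hN : N x ≠ 0 := by
    rw [← norm_ne_zero_iff, H.norm_normal hx]; exact one_ne_zero
  have key' (a b c : E3) := key _ _ _ _ (H.normal x hx a) (H.normal x hx b) (H.normal x hx c) hN
  simp only [fluxCross, inner_add_left, inner_smul_left, key', mul_zero, add_zero]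

omit hY in
theorem fluxCross_ne_zero {x : E3} (hx : x ≠ 0) : fluxCross x (fderiv ℝ R x) ≠ 0 := by
  obtain ⟨u, v, huv⟩ := exists_complementary_pair hx
  intro h
  have h1 := fluxCross_eq (H.fderiv_self hx) u v
  rw [h, smul_zero] at h1
  exact (smul_ne_zero (inner_self_pos_of_ne hx).ne' (H.cross_ne_zero hx huv)) h1.symm

omit hY in
/-- The immersion either preserves or reverses the orientation everywhere. -/
theorem exists_orientation : ∃ ε : ℝ, ∀ x ≠ 0,
    0 < ε * ⟪fluxCross x (fderiv ℝ R x), N x⟫_ℝ := by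
  set s : E3 → ℝ := fun x => ⟪fluxCross x (fderiv ℝ R x), N x⟫_ℝ
  have hs : ContinuousOn s {0}ᶜ := by
    intro x hx
    refine ContinuousAt.continuousWithinAt ?_
    have hc (u : E3) := (contDiffAt_fderiv_apply (H.smooth x hx) u)
    have hcc (u v : E3) := (contDiffAt_crossL (hc u) (hc v)).continuousAt
    have hp (i : Fin 3) : ContinuousAt (fun y : E3 => y i) x := by fun_prop
    exact ((((hp 0).smul (hcc _ _)).add ((hp 1).smul (hcc _ _))).add ((hp 2).smul (hcc _ _))).inner
      (H.smooth_normal x hx).continuousAt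
  have hs0 (x : E3) (hx : x ≠ 0) : s x ≠ 0 := by
    intro h
    have := H.fluxCross_eq_smul_normal hx
    rw [show ⟪fluxCross x (fderiv ℝ R x), N x⟫_ℝ = 0 from h, zero_smul] at this
    exact H.fluxCross_ne_zero hx this
  have hcon : IsPreconnected ({0}ᶜ : Set E3) :=
    (isConnected_compl_singleton_of_one_lt_rank one_lt_rank_E3 0).isPreconnected
  by_cases hpos : ∀ x ≠ 0, 0 < s x
  · exact ⟨1, fun x hx => by rw [one_mul]; exact hpos x hx⟩
  · push Not at hpos
    obtain ⟨y, hy, hys⟩ := hpos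
    refine ⟨-1, fun x hx => ?_⟩
    by_contra hxs
    have hxs' : 0 ≤ s x := by simpa using hxs
    -- A change of sign on the connected punctured space would produce a zero of `s`.
    obtain ⟨z, hz, hz0⟩ := hcon.intermediate_value hy hx hs ⟨hys, hxs'⟩
    exact hs0 z hz hz0

/-- The exterior derivative of the one-form `⟪R - o, Y × dY⟫`. -/
theorem fluxCurl_rotation {x : E3} (hx : x ≠ 0) (o : E3) (c : ℝ) :
    fluxCurl (fun i y => c * ⟪R y - o, crossL (Y y) (fderiv ℝ Y y (EuclideanSpace.single i 1))⟫_ℝ) x =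
      2 * c * ⟪R x - o, fluxCross x (fderiv ℝ Y x)⟫_ℝ := by
  have hd (u v : E3) : fderiv ℝ (fun y => c * ⟪R y - o, crossL (Y y) (fderiv ℝ Y y v)⟫_ℝ) x u =
      c * (⟪Y x, crossL (fderiv ℝ Y x v) (fderiv ℝ R x u)⟫_ℝ +
        ⟪R x - o, crossL (fderiv ℝ Y x u) (fderiv ℝ Y x v)⟫_ℝ +
        ⟪R x - o, crossL (Y x) (fderiv ℝ (fun y => fderiv ℝ Y y v) x u)⟫_ℝ) := by
    have hv := contDiffAt_fderiv_apply (hY.smooth x hx) v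
    have h1 := (hasFDerivAt_of_contDiffAt (H.smooth x hx)).sub_const o
    have h2 := hasFDerivAt_of_contDiffAt (contDiffAt_crossL (hY.smooth x hx) hv)
    rw [((h1.inner ℝ h2).const_mul c).fderiv]
    simp [fderiv_crossL (hY.smooth x hx) hv, inner_add_right,
      inner_crossL_cyclic (fderiv ℝ R x u)]
    exact Or.inl (by ring)
  -- The terms `⟪Y, dY × dR⟫` cancel by integrability and those with `D²Y` by symmetry.
  have hd2 (u v : E3) : fderiv ℝ (fun y => c * ⟪R y - o, crossL (Y y) (fderiv ℝ Y y v)⟫_ℝ) x u -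
      fderiv ℝ (fun y => c * ⟪R y - o, crossL (Y y) (fderiv ℝ Y y u)⟫_ℝ) x v =
        2 * c * ⟪R x - o, crossL (fderiv ℝ Y x u) (fderiv ℝ Y x v)⟫_ℝ := by
    rw [hd, hd, hY.symm x hx, fderiv_fderiv_apply_comm (hY.smooth x hx) u v,
      crossL_anticomm (fderiv ℝ Y x v) (fderiv ℝ Y x u), inner_neg_right]
    ring
  simp only [fluxCurl, hd2, fluxCross, inner_add_right, inner_smul_right]
  ring

/-- Rotation fields along convex surfaces are constant. -/
theorem fderiv_rotation_eq_zero {x : E3} (hx : x ≠ 0) : fderiv ℝ Y x = 0 := by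
  obtain ⟨ε, hε⟩ := H.exists_orientation
  have hnx : -x ≠ 0 := neg_ne_zero.2 hx
  -- With the base point on the surface, the support function `⟪R - o, N⟫` is nonnegative everywhere
  -- and positive at `x`, whose ray differs from that of `-x`. No interior point is needed.
  set o := R (-x)
  set A : Fin 3 → E3 → ℝ := fun i y =>
    -ε * ⟪R y - o, crossL (Y y) (fderiv ℝ Y y (EuclideanSpace.single i 1))⟫_ℝ
  have hA (i : Fin 3) (y : E3) (hy : y ≠ 0) : ContDiffAt ℝ ∞ (A i) y :=
    contDiffAt_const.mul (((H.smooth y hy).sub contDiffAt_const).inner ℝ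
      (contDiffAt_crossL (hY.smooth y hy) (contDiffAt_fderiv_apply (hY.smooth y hy) _)))
  have hflux {y : E3} (hy : y ≠ 0) : ∃ k : ℝ, k ≤ 0 ∧ (k = 0 → fderiv ℝ Y y = 0) ∧
      fluxCurl A y = 2 * (-k) * (ε * ⟪fluxCross y (fderiv ℝ R y), N y⟫_ℝ) *
        ⟪R y - o, N y⟫_ℝ := by
    obtain ⟨k, hk, hk1, hk2⟩ := H.fluxCross_rotation hY hy
    refine ⟨k, hk, hk2, ?_⟩
    rw [H.fluxCurl_rotation hY hy, hk1, inner_smul_right, H.fluxCross_eq_smul_normal hy,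
      inner_smul_right, ← H.fluxCross_eq_smul_normal hy]
    ring
  have hpos (y : E3) (hy : y ≠ 0) : 0 ≤ fluxCurl A y := by
    obtain ⟨k, hk, -, h⟩ := hflux hy
    rw [h]
    have h1 : 0 ≤ ⟪R y - o, N y⟫_ℝ := by
      by_cases hyx : sphereProj (-x) = sphereProj y
      · have : R y = o := by
          rw [← H.apply_sphereProj hy, ← hyx, H.apply_sphereProj hnx]
        simp [this]
      · exact (H.support_pos hy hnx hyx).le
    have h2 := (hε y hy).le
    have h3 : 0 ≤ -k := by linarith
    positivity
  have hz := fluxCurl_eq_zero_of_nonneg hA hpos hx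
  obtain ⟨k, hk, hk0, h⟩ := hflux hx
  apply hk0
  have hxx : sphereProj (-x) ≠ sphereProj x := by
    intro h
    have h1 := congrArg Subtype.val h
    rw [coe_sphereProj hx, coe_sphereProj hnx, norm_neg, smul_neg] at h1
    have h2 : ‖x‖⁻¹ • x = 0 := by
      have h3 : (2 : ℝ) • (‖x‖⁻¹ • x) = 0 := by
        rw [two_smul]; nth_rewrite 1 [← h1]; exact neg_add_cancel _
      exact (smul_eq_zero.1 h3).resolve_left two_ne_zero
    exact (smul_ne_zero (inv_ne_zero (norm_ne_zero_iff.2 hx)) hx) h2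
  have h1 := H.support_pos hx hnx hxx
  rw [hz] at h
  by_contra hne
  have h3 : 0 < -k := by
    have := lt_of_le_of_ne hk hne
    linarith
  have h4 := hε x hx
  have : 0 < 2 * (-k) * (ε * ⟪fluxCross x (fderiv ℝ R x), N x⟫_ℝ) * ⟪R x - o, N x⟫_ℝ := by
    positivity
  exact this.ne h

omit hY in
/-- Infinitesimal rigidity of convex surfaces in Euclidean space. -/
theorem euclidean_rigidity {T : E3 → E3} (hT : IsEuclideanDeformation R T) :
    ∃ A B : E3, ∀ x ≠ 0, T x = crossL A (R x) + B := by
  obtain ⟨Y, hYs, hTY⟩ := H.exists_rotation_field hT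
  have hY : IsRotationField R Y :=
    ⟨hYs, fun x hx u v => H.crossL_fderiv_rotation_symm hT hYs hTY hx u v⟩
  have hopen : IsOpen ({0}ᶜ : Set E3) := isOpen_compl_singleton
  have hcon : IsPreconnected ({0}ᶜ : Set E3) :=
    (isConnected_compl_singleton_of_one_lt_rank one_lt_rank_E3 0).isPreconnected
  obtain ⟨A, hA⟩ := hopen.exists_is_const_of_fderiv_eq_zero hcon
    (fun x hx => ((hYs x hx).differentiableAt (by simp)).differentiableWithinAt)
    (fun x hx => H.fderiv_rotation_eq_zero hY hx)
  have hD {x : E3} (hx : x ≠ 0) : HasFDerivAt (fun y => T y - crossL A (R y)) (0 : E3 →L[ℝ] E3) x := by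
    have h1 := (hasFDerivAt_of_contDiffAt (hT.smooth x hx)).sub
      ((crossL A).hasFDerivAt.comp x (hasFDerivAt_of_contDiffAt (H.smooth x hx)))
    have h2 : fderiv ℝ T x - crossL A ∘L fderiv ℝ R x = 0 := by
      ext1 v
      simp [hTY x hx, hA x hx]
    rw [h2] at h1
    exact h1
  obtain ⟨B, hB⟩ := hopen.exists_is_const_of_fderiv_eq_zero hcon
    (fun x hx => (hD hx).differentiableAt.differentiableWithinAt) (fun x hx => (hD hx).fderiv)
  refine ⟨A, B, fun x hx => ?_⟩
  rw [← hB x hx]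
  abel

end IsConvexImmersion

/-! ### Radial extension of maps on the sphere -/

theorem contMDiffAt_sphereProj {x : E3} (hx : x ≠ 0) :
    ContMDiffAt 𝓘(ℝ, E3) (𝓡 2) ∞ sphereProj x := by
  have : Fact (Module.finrank ℝ E3 = 2 + 1) := ⟨by simp⟩
  let U : TopologicalSpace.Opens E3 := ⟨{0}ᶜ, isOpen_compl_singleton⟩
  have hU (y : U) : (y : E3) ≠ 0 := y.2
  have h1 : ContMDiff 𝓘(ℝ, E3) 𝓘(ℝ, E3) ∞ (fun y : U => (‖(y : E3)‖⁻¹ • (y : E3) : E3)) := by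
    intro y
    refine (contMDiffAt_subtype_iff (f := fun y : E3 => ‖y‖⁻¹ • y)).2 ?_
    exact (((contDiffAt_norm ℝ (hU y)).inv (norm_ne_zero_iff.2 (hU y))).smul
      contDiffAt_id).contMDiffAt
  have h2 (y : U) : ‖(y : E3)‖⁻¹ • (y : E3) ∈ Metric.sphere (0 : E3) 1 := by
    simp [norm_smul, inv_mul_cancel₀ (norm_ne_zero_iff.2 (hU y))]
  have h3 := h1.codRestrict_sphere (n := 2) h2
  have h4 : (Set.codRestrict _ _ h2 : U → S2) = fun y : U => sphereProj y := by
    funext y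
    exact Subtype.ext (coe_sphereProj (hU y)).symm
  rw [h4] at h3
  exact contMDiffAt_subtype_iff.1 (h3 ⟨x, hx⟩)

/-- The differential of the radial projection. -/
def sphereProjDeriv (x : E3) : E3 →L[ℝ] TangentSpace (𝓡 2) (sphereProj x) :=
  mfderiv 𝓘(ℝ, E3) (𝓡 2) sphereProj x

theorem contDiffAt_comp_sphereProj {V : S2 → E3} (hV : ContMDiff (𝓡 2) 𝓘(ℝ, E3) ∞ V) {x : E3}
    (hx : x ≠ 0) : ContDiffAt ℝ ∞ (fun y => V (sphereProj y)) x :=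
  ((hV (sphereProj x)).comp x (contMDiffAt_sphereProj hx)).contDiffAt

theorem fderiv_comp_sphereProj {V : S2 → E3} (hV : ContMDiff (𝓡 2) 𝓘(ℝ, E3) ∞ V) {x : E3}
    (hx : x ≠ 0) (v : E3) : fderiv ℝ (fun y => V (sphereProj y)) x v =
      differential V (sphereProj x) (sphereProjDeriv x v) := by
  have h := mfderiv_comp x ((hV (sphereProj x)).mdifferentiableAt (by simp))
    ((contMDiffAt_sphereProj hx).mdifferentiableAt (by simp))
  rw [mfderiv_eq_fderiv] at h
  exact DFunLike.congr_fun h v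

/-- Crossing the derivative of `‖y‖⁻¹ y` along `v` with `x` removes the radial term and leaves
`‖x‖⁻¹ (x × v)`. -/
theorem sphereProjDeriv_ne_zero {x v : E3} (hx : x ≠ 0) (hv : crossL x v ≠ 0) :
    sphereProjDeriv x v ≠ 0 := by
  have : Fact (Module.finrank ℝ E3 = 2 + 1) := ⟨by simp⟩
  intro h0
  have h1 := fderiv_comp_sphereProj (V := fun p : S2 => (p : E3)) (contMDiff_coe_sphere (n := 2)) hx v
  have h2 : differential (fun p : S2 => (p : E3)) (sphereProj x) (sphereProjDeriv x v) = 0 := by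
    rw [h0]
    exact map_zero (mfderiv (𝓡 2) 𝓘(ℝ, E3) (fun p : S2 => (p : E3)) (sphereProj x))
  rw [h2] at h1
  have h3 : (fun y : E3 => (sphereProj y : E3)) =ᶠ[nhds x] fun y => ‖y‖⁻¹ • y := by
    filter_upwards [isOpen_ne.mem_nhds hx] with y hy using coe_sphereProj hy
  have hd : ContDiffAt ℝ ∞ (fun y : E3 => ‖y‖⁻¹) x :=
    (contDiffAt_norm ℝ hx).inv (norm_ne_zero_iff.2 hx)
  have h4 := (hasFDerivAt_of_contDiffAt hd).smul (hasFDerivAt_id x)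
  have h5 : fderiv ℝ (fun y : E3 => ‖y‖⁻¹ • y) x = _ := h4.fderiv
  rw [h3.fderiv_eq, h5] at h1
  have h6 := congrArg (crossL x) h1
  simp [crossL_self, hx] at h6
  exact hv h6

/-! ### From hyperbolic to Euclidean space -/

theorem staticPotential_pos {κ : ℝ} (hκ : 0 < κ) (x : E3) : 0 < staticPotential κ x :=
  Real.sqrt_pos.2 (one_add_pos hκ x)

theorem staticPotential_sq {κ : ℝ} (hκ : 0 < κ) (x : E3) :
    staticPotential κ x ^ 2 = 1 + κ * ⟪x, x⟫_ℝ := by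
  rw [staticPotential, Real.sq_sqrt (one_add_pos hκ x).le, real_inner_self_eq_norm_sq]

theorem hypMetric_eq {κ : ℝ} (hκ : 0 < κ) (x u v : E3) : hypMetric κ x u v =
    ⟪u, v⟫_ℝ - κ * ⟪x, u⟫_ℝ * ⟪x, v⟫_ℝ / staticPotential κ x ^ 2 := by
  rw [staticPotential_sq hκ, real_inner_self_eq_norm_sq, hypMetric]

theorem hypMetric_comm (κ : ℝ) (x u v : E3) : hypMetric κ x u v = hypMetric κ x v u := by
  simp only [hypMetric, real_inner_comm u v]
  ring

theorem hypMetric_add_left (κ : ℝ) (x u v w : E3) :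
    hypMetric κ x (u + v) w = hypMetric κ x u w + hypMetric κ x v w := by
  simp only [hypMetric, inner_add_left, inner_add_right]
  ring

theorem hypMetric_smul_left (κ c : ℝ) (x u w : E3) :
    hypMetric κ x (c • u) w = c * hypMetric κ x u w := by
  simp only [hypMetric, inner_smul_left, inner_smul_right, conj_trivial]
  ring

theorem contDiff_staticPotential {κ : ℝ} (hκ : 0 < κ) : ContDiff ℝ ∞ (staticPotential κ) := by
  have h : ContDiff ℝ ∞ (fun x : E3 => 1 + κ * ‖x‖ ^ 2) :=
    contDiff_const.add (contDiff_const.mul (contDiff_norm_sq ℝ))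
  exact h.sqrt fun x => (one_add_pos hκ x).ne'

theorem fderiv_staticPotential {κ : ℝ} (hκ : 0 < κ) (x v : E3) :
    fderiv ℝ (staticPotential κ) x v = κ * ⟪x, v⟫_ℝ / staticPotential κ x := by
  have hf := staticPotential_pos hκ x
  have h1 := (hasFDerivAt_of_contDiffAt (contDiff_staticPotential hκ).contDiffAt (x := x))
  have h2 := (h1.mul h1).congr_of_eventuallyEq (f₁ := fun y => 1 + κ * ‖y‖ ^ 2)
    (Filter.Eventually.of_forall fun y => by
      simp only [Pi.mul_apply]
      rw [← sq, staticPotential_sq hκ, real_inner_self_eq_norm_sq])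
  have h3 := ((hasStrictFDerivAt_norm_sq x).hasFDerivAt.const_mul κ).const_add 1
  have h4 := DFunLike.congr_fun (h2.unique h3) v
  simp at h4
  field_simp
  linarith

/-- The factor `f` of `X` cancels the `f⁻¹` of the cross product, and the radial correction vanishes
since `A × x ⊥ x`. -/
theorem killingField_eq {κ : ℝ} (hκ : 0 < κ) (A B x : E3) :
    killingField κ A B x = crossL A x + staticPotential κ x • B := by
  have hf := (staticPotential_pos hκ x).ne'
  rw [killingField, hypCross, confKilling, ← crossL_apply, map_smul, inner_smul_right,
    inner_crossL_right, mul_zero, mul_zero, zero_smul, add_zero, smul_smul, inv_mul_cancel₀ hf,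
    one_smul]

theorem isKillingField_killingField {κ : ℝ} (hκ : 0 < κ) (A B : E3) :
    IsKillingField κ (killingField κ A B) := by
  have hW : killingField κ A B = fun x => crossL A x + staticPotential κ x • B :=
    funext (killingField_eq hκ A B)
  have hs := contDiff_staticPotential hκ
  refine ⟨?_, fun x u v => ?_⟩
  · rw [hW]
    exact (crossL A).contDiff.add (hs.smul contDiff_const)
  have hD (w : E3) : fderiv ℝ (killingField κ A B) x w =
      crossL A w + (κ * ⟪x, w⟫_ℝ / staticPotential κ x) • B := by
    have h := (crossL A).hasFDerivAt.add
      ((hasFDerivAt_of_contDiffAt hs.contDiffAt (x := x)).smul_const B)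
    have h' : fderiv ℝ (fun x => crossL A x + staticPotential κ x • B) x = _ := h.fderiv
    rw [hW, h']
    simp [fderiv_staticPotential hκ]
  have hf := (staticPotential_pos hκ x).ne'
  have hsq := staticPotential_sq hκ x
  simp only [covDeriv, christoffel, hD, killingField_eq hκ, hypMetric_eq hκ, inner_add_left,
    inner_add_right, inner_smul_left, inner_smul_right, inner_crossL_right, conj_trivial]
  have e1 : ⟪crossL A u, v⟫_ℝ = -⟪u, crossL A v⟫_ℝ := by
    simp [inner_eq_coord]; ring
  have e2 (w : E3) : ⟪w, crossL A x⟫_ℝ = -⟪x, crossL A w⟫_ℝ := by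
    simp [inner_eq_coord]; ring
  rw [e1, e2 u, e2 v, real_inner_comm x u, real_inner_comm v B]
  set s := staticPotential κ x
  generalize ⟪x, x⟫_ℝ = q at *
  have hq : κ * q = s ^ 2 - 1 := by linarith
  field_simp
  linear_combination
    (κ * ⟪x, v⟫_ℝ * (s ^ 2 * (-⟪x, crossL A u⟫_ℝ + s * ⟪u, B⟫_ℝ) - κ * ⟪x, u⟫_ℝ * (s * ⟪x, B⟫_ℝ)) +
      κ * ⟪x, u⟫_ℝ * (s ^ 2 * (-⟪x, crossL A v⟫_ℝ + s * ⟪v, B⟫_ℝ) -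
        κ * (s * ⟪x, B⟫_ℝ) * ⟪x, v⟫_ℝ)) * hq

/-- The radial extension of the image of `r` in the projective model. -/
def projectiveModel (κ : ℝ) (r V : S2 → E3) (x : E3) : E3 :=
  (staticPotential κ (r (sphereProj x)))⁻¹ • V (sphereProj x)

theorem contDiffAt_projectiveModel {κ : ℝ} (hκ : 0 < κ) {r V : S2 → E3}
    (hr : ContMDiff (𝓡 2) 𝓘(ℝ, E3) ∞ r) (hV : ContMDiff (𝓡 2) 𝓘(ℝ, E3) ∞ V) {x : E3}
    (hx : x ≠ 0) : ContDiffAt ℝ ∞ (projectiveModel κ r V) x :=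
  (((contDiff_staticPotential hκ).contDiffAt.comp x (contDiffAt_comp_sphereProj hr hx)).inv
    (staticPotential_pos hκ _).ne').smul (contDiffAt_comp_sphereProj hV hx)

theorem fderiv_projectiveModel {κ : ℝ} (hκ : 0 < κ) {r V : S2 → E3}
    (hr : ContMDiff (𝓡 2) 𝓘(ℝ, E3) ∞ r) (hV : ContMDiff (𝓡 2) 𝓘(ℝ, E3) ∞ V) {x : E3}
    (hx : x ≠ 0) (v : E3) : fderiv ℝ (projectiveModel κ r V) x v =
      (staticPotential κ (r (sphereProj x)))⁻¹ •
        (differential V (sphereProj x) (sphereProjDeriv x v) -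
          (κ * ⟪r (sphereProj x), differential r (sphereProj x) (sphereProjDeriv x v)⟫_ℝ /
            staticPotential κ (r (sphereProj x)) ^ 2) • V (sphereProj x)) := by
  have hf := (staticPotential_pos hκ (r (sphereProj x))).ne'
  have h1 : HasFDerivAt (fun y => staticPotential κ (r (sphereProj y))) _ x :=
    (hasFDerivAt_of_contDiffAt (contDiff_staticPotential hκ).contDiffAt).comp x
      (hasFDerivAt_of_contDiffAt (contDiffAt_comp_sphereProj hr hx))
  have h2 : HasFDerivAt (fun y => (staticPotential κ (r (sphereProj y)))⁻¹) _ x :=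
    (hasDerivAt_inv hf).comp_hasFDerivAt x h1
  have h3 : HasFDerivAt (projectiveModel κ r V) _ x :=
    h2.smul (hasFDerivAt_of_contDiffAt (contDiffAt_comp_sphereProj hV hx))
  rw [h3.fderiv]
  simp [fderiv_staticPotential hκ, fderiv_comp_sphereProj hr hx, fderiv_comp_sphereProj hV hx,
    smul_sub, smul_smul]
  rw [← sub_eq_add_neg]
  congr 2
  field_simp

/-- The term that `d(f⁻¹)` contributes to `d(r / f)` is exactly the one by which `g` differs from
the Euclidean product. Hence `g`-normals of `r` are Euclidean normals of `R`. -/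
theorem inner_fderiv_projectiveModel {κ : ℝ} (hκ : 0 < κ) {r : S2 → E3}
    (hr : ContMDiff (𝓡 2) 𝓘(ℝ, E3) ∞ r) {x : E3} (hx : x ≠ 0) (w v : E3) :
    ⟪w, fderiv ℝ (projectiveModel κ r r) x v⟫_ℝ = (staticPotential κ (r (sphereProj x)))⁻¹ *
      hypMetric κ (r (sphereProj x)) w (differential r (sphereProj x) (sphereProjDeriv x v)) := by
  rw [fderiv_projectiveModel hκ hr hr hx, inner_smul_right, inner_sub_right, inner_smul_right,
    hypMetric_eq hκ, real_inner_comm w (r (sphereProj x))]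
  ring

/-- The Christoffel term is a multiple of `r`, and `g(r, w) = ⟪r, w⟫ / f²`. -/
theorem hypMetric_covDerivAlong {κ : ℝ} (hκ : 0 < κ) (r V : S2 → E3) (p : S2)
    (ξ : TangentSpace (𝓡 2) p) (w : E3) :
    hypMetric κ (r p) (covDerivAlong κ r V p ξ) w = hypMetric κ (r p) (differential V p ξ) w -
      κ * hypMetric κ (r p) (differential r p ξ) (V p) * ⟪r p, w⟫_ℝ /
        staticPotential κ (r p) ^ 2 := by
  have hf := (staticPotential_pos hκ (r p)).ne'
  have hq : κ * ⟪r p, r p⟫_ℝ = staticPotential κ (r p) ^ 2 - 1 := by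
    rw [staticPotential_sq hκ]; ring
  rw [covDerivAlong, christoffel]
  generalize hypMetric κ (r p) (differential r p ξ) (V p) = m
  simp only [hypMetric_eq hκ, inner_add_left, inner_add_right, inner_smul_left, inner_smul_right,
    conj_trivial]
  field_simp
  linear_combination (m * κ * ⟪r p, w⟫_ℝ) * hq

/-- In `⟪dR u, dT v⟫` the derivative of `f⁻¹` yields the Christoffel term of `g(dr u, D_v τ)` with
`u` and `v` exchanged, so after symmetrization the two equations agree up to the factor `2 f⁻²`. -/
theorem isEuclideanDeformation_projectiveModel {κ : ℝ} (hκ : 0 < κ) {r τ : S2 → E3}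
    (hr : ContMDiff (𝓡 2) 𝓘(ℝ, E3) ∞ r) (hτ : IsInfinitesimalDeformation κ r τ) :
    IsEuclideanDeformation (projectiveModel κ r r) (projectiveModel κ r τ) where
  smooth x hx := contDiffAt_projectiveModel hκ hr hτ.smooth hx
  radial x hx t ht := by simp only [projectiveModel, sphereProj_smul hx ht]
  equation x hx u v := by
    have h := hτ.equation (sphereProj x) (sphereProjDeriv x u) (sphereProjDeriv x v)
    rw [symProd, hypMetric_comm κ _ _ (covDerivAlong _ _ _ _ _),
      hypMetric_comm κ _ _ (covDerivAlong _ _ _ _ (sphereProjDeriv x u)),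
      hypMetric_covDerivAlong hκ, hypMetric_covDerivAlong hκ] at h
    rw [real_inner_comm, inner_fderiv_projectiveModel hκ hr hx,
      real_inner_comm (fderiv ℝ (projectiveModel κ r τ) x u), inner_fderiv_projectiveModel hκ hr hx,
      fderiv_projectiveModel hκ hr hτ.smooth hx, fderiv_projectiveModel hκ hr hτ.smooth hx]
    simp only [sub_eq_add_neg, ← neg_smul, hypMetric_add_left, hypMetric_smul_left]
    rw [hypMetric_comm κ _ (τ _), hypMetric_comm κ _ (τ _)]
    linear_combination (2 * ((staticPotential κ (r (sphereProj x)))⁻¹) ^ 2) * h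

/-- The Euclidean form `⟪dN v, dR v⟫` is `‖ν‖⁻¹ f⁻¹ h`: the derivative of `‖ν‖⁻¹` multiplies the
normal `ν`, and the Christoffel term of `h` contains the factor `g(dr, ν) = 0`. -/
theorem isConvexImmersion_projectiveModel {κ : ℝ} (hκ : 0 < κ) {r ν : S2 → E3}
    (hr : ContMDiff (𝓡 2) 𝓘(ℝ, E3) ∞ r) (hν : IsUnitNormal κ r ν)
    (hconv : ∀ (p : S2) (ξ : TangentSpace (𝓡 2) p), ξ ≠ 0 →
      0 < secondFundamentalForm κ r ν p ξ ξ) :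
    IsConvexImmersion (projectiveModel κ r r)
      (fun x => ‖ν (sphereProj x)‖⁻¹ • ν (sphereProj x)) := by
  have hν0 (p : S2) : ν p ≠ 0 := by
    intro h
    have := hν.unit p
    simp [h, hypMetric] at this
  have hνs {x : E3} (hx : x ≠ 0) := contDiffAt_comp_sphereProj hν.smooth hx
  have hinv {x : E3} (hx : x ≠ 0) : ContDiffAt ℝ ∞ (fun y => ‖ν (sphereProj y)‖⁻¹) x :=
    ((hνs hx).norm ℝ (hν0 _)).inv (norm_ne_zero_iff.2 (hν0 _))
  have hg (p : S2) (ξ : TangentSpace (𝓡 2) p) := hν.normal p ξ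
  refine ⟨fun x hx => contDiffAt_projectiveModel hκ hr hr hx, fun x hx => (hinv hx).smul (hνs hx),
    fun x hx t ht => by simp only [projectiveModel, sphereProj_smul hx ht],
    fun x hx t ht => by simp only [sphereProj_smul hx ht], fun x hx => ?_, fun x hx v => ?_,
    fun x hx v hv => ?_⟩
  · rw [real_inner_self_eq_norm_sq, norm_smul, norm_inv, norm_norm,
      inv_mul_cancel₀ (norm_ne_zero_iff.2 (hν0 _)), one_pow]
  · rw [inner_smul_left, inner_fderiv_projectiveModel hκ hr hx, hg]
    simp
  · have h1 := (hasFDerivAt_of_contDiffAt (hinv hx)).smul (hasFDerivAt_of_contDiffAt (hνs hx))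
    have h2 : fderiv ℝ (fun x => ‖ν (sphereProj x)‖⁻¹ • ν (sphereProj x)) x = _ := h1.fderiv
    rw [h2, inner_fderiv_projectiveModel hκ hr hx]
    have h3 := hconv (sphereProj x) _ (sphereProjDeriv_ne_zero hx hv)
    rw [secondFundamentalForm, hypMetric_covDerivAlong hκ, hypMetric_comm κ _ _ (ν _), hg] at h3
    simp only [mul_zero, zero_mul, zero_div, sub_zero] at h3
    simp only [add_apply, smul_apply, ContinuousLinearMap.smulRight_apply,
      hypMetric_add_left, hypMetric_smul_left, hg, fderiv_comp_sphereProj hν.smooth hx, mul_zero,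
      add_zero]
    have h4 := staticPotential_pos hκ (r (sphereProj x))
    have h5 := norm_pos_iff.2 (hν0 (sphereProj x))
    positivity

end HypRigid

end

/-! ### Rigidity in hyperbolic space. -/

theorem mainTheorem5 (κ : ℝ) (hκ : 0 < κ) (σ : HypRigid.SphereMetric)
    (r : HypRigid.S2 → HypRigid.E3) (hr : HypRigid.IsIsometricEmbedding κ σ r)
    (hconv : HypRigid.IsConvexSurface κ r) :
    HypRigid.IsInfinitesimallyRigid κ r ∧
      ∀ τ : HypRigid.S2 → HypRigid.E3, HypRigid.IsInfinitesimalDeformation κ r τ →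
        ∃ Y₀ Z₀ : HypRigid.E3, HypRigid.IsKillingField κ (HypRigid.killingField κ Y₀ Z₀) ∧
          ∀ p : HypRigid.S2, τ p = HypRigid.killingField κ Y₀ Z₀ (r p) := by
  have key : ∀ τ : HypRigid.S2 → HypRigid.E3, HypRigid.IsInfinitesimalDeformation κ r τ →
      ∃ Y₀ Z₀ : HypRigid.E3, HypRigid.IsKillingField κ (HypRigid.killingField κ Y₀ Z₀) ∧
        ∀ p : HypRigid.S2, τ p = HypRigid.killingField κ Y₀ Z₀ (r p) := by
    intro τ hτ
    obtain ⟨ν, hν, hpos⟩ := hconv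
    obtain ⟨A, B, h⟩ := (HypRigid.isConvexImmersion_projectiveModel hκ hr.smooth hν
      hpos).euclidean_rigidity (HypRigid.isEuclideanDeformation_projectiveModel hκ hr.smooth hτ)
    refine ⟨A, B, HypRigid.isKillingField_killingField hκ A B, fun p => ?_⟩
    have hf := (HypRigid.staticPotential_pos hκ (r p)).ne'
    have h1 := h p (ne_zero_of_mem_unit_sphere p)
    simp only [HypRigid.projectiveModel, HypRigid.sphereProj_coe] at h1
    -- Multiply `τ / f = A × (r / f) + B` by `f`.
    rw [HypRigid.killingField_eq hκ, (inv_smul_eq_iff₀ hf).1 h1, map_smul, smul_add, smul_smul,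
      mul_inv_cancel₀ hf, one_smul]
  refine ⟨fun τ hτ => ?_, key⟩
  obtain ⟨A, B, hK, h⟩ := key τ hτ
  exact ⟨_, hK, h⟩
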